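/- Let $\mathbb{k}$ be a field, $Q=\mathbb{k}[x_1,\dots,x_n]$, let $c\ge 1$, let $a_1,\dots,a_c$ be a regular sequence in $Q$, put $\mathfrak a=\langle a_1,\dots,a_c\rangle$ and $R=Q/\mathfrak a$. Let $I=\langle m_1,\dots,m_r\rangle\subseteq Q$ be an ideal generated by $r$ monomials (not necessarily minimally), with $\mathfrak a\subseteq I$, and write $R/I$ for $R/IR\cong Q/I$. Let $\beta_i=\dim_{\mathbb{k}}\operatorname{Tor}_i^R\bigl(R/\langle x_1,\dots,x_n\rangle R,\;R/I\bigr)$ be the total Betti numbers of $R/I$ over $R$ (if $I\neq Q$, then $R/\langle x_1,\dots,x_n\rangle R=\mathbb{k}$; if the $a_i$ are moreover homogeneous, $\beta_i$ is the rank of the $i$-th module in the minimal graded free resolution of $R/I$). Then for all $m\ge 0$ $$\beta_{2m}\le\sum_{j=0}^m\binom{r}{2j}\binom{c+m-j-1}{c-1},\qquad \beta_{2m+1}\le\sum_{j=0}^m\binom{r}{2j+1}\binom{c+m-j-1}{c-1}.$$ Moreover, these bounds are the ranks of the modules in the following free resolution of $R/I$. Write $a_i=\sum_{t=1}^r f_{i,t}m_t$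 with $f_{i,t}\in Q$, in any way. For $S\subseteq\{1,\dots,r\}$ let $m_S=\operatorname{lcm}(m_s:s\in S)$ (so $m_\emptyset=1$), and for $t\in\{1,\dots,r\}$ let $\epsilon(t,S)=(-1)^{\#\{s\in S\,:\,s>t\}}$. Let $\Phi_i$ be the free $R$-module with basis the symbols $y^{(u)}\varepsilon_S$, where $u\in\mathbb{N}^c$, $S\subseteq\{1,\dots,r\}$ and $2|u|+|S|=i$, and let $\varphi:\Phi_{i+1}\to\Phi_i$ be given by $$\varphi(y^{(u)}\varepsilon_S)=\sum_{s\in S}\epsilon(s,S)\,\frac{m_S}{m_{S\setminus s}}\,y^{(u)}\varepsilon_{S\setminus s}+\sum_{j:\,u_j>0}\ \sum_{t\notin S}\epsilon(t,S)\,\frac{f_{j,t}\,m_t\,m_S}{m_{S\cup t}}\,y^{(u-e_j)}\varepsilon_{S\cup t},$$ where $e_j$ is the $j$-th standard basis vector of $\mathbb{N}^c$. Then $\cdots\to\Phi_2\to\Phi_1\to\Phi_0=R\to R/I\to 0$ is exact, and for all $m\ge 0$ $$\operatorname{rank}_R\Phi_{2m}=\sum_{j=0}^m\binom{r}{2j}\binom{c+m-j-1}{c-1},\qquad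 \operatorname{rank}_R\Phi_{2m+1}=\sum_{j=0}^m\binom{r}{2j+1}\binom{c+m-j-1}{c-1}.$$ -/

import Mathlib

open CategoryTheory

universe u

namespace TaylorCI

noncomputable section

section Ideals

variable {𝕜 : Type u} [Field 𝕜] {n r c : ℕ}

/-- The ideal `⟨x^{μ 1}, …, x^{μ r}⟩` of `𝕜[x₁, …, xₙ]`; a monomial is given by its exponent. -/
def monIdeal (𝕜 : Type u) [Field 𝕜] (μ : Fin r → (Fin n →₀ ℕ)) :
    Ideal (MvPolynomial (Fin n) 𝕜) :=
  Ideal.span (Set.range fun t => MvPolynomial.monomial (μ t) (1 : 𝕜))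

/-- The ring `R = 𝕜[x₁, …, xₙ] / ⟨a₁, …, a_c⟩`. -/
abbrev CIRing (a : Fin c → MvPolynomial (Fin n) 𝕜) : Type u :=
  MvPolynomial (Fin n) 𝕜 ⧸ Ideal.span (Set.range a)

/-- The quotient map `𝕜[x₁, …, xₙ] → R`. -/
abbrev toCI (a : Fin c → MvPolynomial (Fin n) 𝕜) : MvPolynomial (Fin n) 𝕜 →+* CIRing a :=
  Ideal.Quotient.mk (Ideal.span (Set.range a))

/-- The `R`-module `R / I`, where `I` is generated by the images of the monomials `x^{μ t}`. -/
abbrev QuotMod (a : Fin c → MvPolynomial (Fin n) 𝕜) (μ : Fin r → (Fin n →₀ ℕ)) : Type u :=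
  CIRing a ⧸ (monIdeal 𝕜 μ).map (toCI a)

/-- The `R`-module `R / ⟨x₁, …, xₙ⟩`. It is the residue field `𝕜` as soon as all `aᵢ` have
zero constant term. -/
abbrev ResMod (a : Fin c → MvPolynomial (Fin n) 𝕜) : Type u :=
  CIRing a ⧸
    (Ideal.span (Set.range (MvPolynomial.X : Fin n → MvPolynomial (Fin n) 𝕜))).map (toCI a)

/-- The total Betti number `βᵢ(R/I) = dim_𝕜 Torᵢ^R(𝕜, R/I)`, as a cardinal. -/
def betti (a : Fin c → MvPolynomial (Fin n) 𝕜) (μ : Fin r → (Fin n →₀ ℕ)) (i : ℕ) : Cardinal.{u} :=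
  Module.rank 𝕜 (RestrictScalars 𝕜 (CIRing a)
    (((Tor (ModuleCat.{u} (CIRing a)) i).obj (ModuleCat.of (CIRing a) (ResMod a))).obj
      (ModuleCat.of (CIRing a) (QuotMod a μ))))

end Ideals

section Resolution

variable {𝕜 : Type u} [Field 𝕜] {n r c : ℕ}

/-- A sequence `⋯ → F 1 → F 0 → M → 0` of free modules that is exact everywhere. -/
structure IsFreeResolution {R : Type u} [CommRing R] {M : Type u} [AddCommGroup M] [Module R M]
    (F : ℕ → Type u) [∀ i, AddCommGroup (F i)] [∀ i, Module R (F i)]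
    (d : ∀ i, F (i + 1) →ₗ[R] F i) (ε : F 0 →ₗ[R] M) : Prop where
  free : ∀ i, Module.Free R (F i)
  surjective : Function.Surjective ε
  exact_zero : Function.Exact (d 0) ε
  exact_succ : ∀ i, Function.Exact (d (i + 1)) (d i)

/-- The exponent of `m_S = lcm (m_s : s ∈ S)`. -/
def lcmExp (μ : Fin r → (Fin n →₀ ℕ)) (S : Finset (Fin r)) : Fin n →₀ ℕ := S.sup μ

/-- `(-1)` to the number of elements of `S` that are greater than `t`. If `t = sᵢ` in
`S = {s₁ < ⋯ < s_k}` this is `(-1)^(k-i)`; if `t ∉ S` has position `p` in `S ∪ {t}` it is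
`(-1)^(k+1-p) = (-1)^(k-p-1)`. -/
def sgn (R : Type u) [CommRing R] (t : Fin r) (S : Finset (Fin r)) : R :=
  (-1) ^ (S.filter (fun s => t < s)).card

/-- The labels of the basis elements `y^(u) ⊗ ε_S` of homological degree `2|u| + |S| = i`. -/
abbrev Label (c r i : ℕ) : Type :=
  {p : (Fin c → ℕ) × Finset (Fin r) // 2 * ∑ j, p.1 j + p.2.card = i}

/-- The term `Φᵢ = ⨁_{2|u| + |S| = i} R · y^(u) ε_S` of the Eisenbud–Shamash construction on
the Taylor resolution. -/
abbrev Term (r : ℕ) (a : Fin c → MvPolynomial (Fin n) 𝕜) (i : ℕ) : Type u :=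
  Label c r i →₀ CIRing a

lemma label_erase {i : ℕ} (p : Label c r (i + 1)) (s : Fin r) (hs : s ∈ p.1.2) :
    2 * ∑ j, p.1.1 j + (p.1.2.erase s).card = i := by
  have h := p.2
  have := Finset.card_erase_add_one hs
  omega

lemma sum_sub_single (u : Fin c → ℕ) (j : Fin c) (hj : 0 < u j) :
    ∑ l, (u - (Pi.single j 1 : Fin c → ℕ)) l + 1 = ∑ l, u l := by
  have e : ∑ l, (Pi.single j 1 : Fin c → ℕ) l = 1 := by simp
  conv_lhs => rw [← e]
  rw [← Finset.sum_add_distrib]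
  refine Finset.sum_congr rfl fun l _ => ?_
  by_cases hl : l = j
  · subst hl
    simp
    omega
  · simp [hl]

lemma label_insert {i : ℕ} (p : Label c r (i + 1)) (j : Fin c) (hj : 0 < p.1.1 j)
    (t : Fin r) (ht : t ∉ p.1.2) :
    2 * ∑ l, (p.1.1 - (Pi.single j 1 : Fin c → ℕ)) l + (insert t p.1.2).card = i := by
  have h := p.2
  have h1 := Finset.card_insert_of_notMem ht
  have h2 := sum_sub_single p.1.1 j hj
  omega

/-- The differential on the basis element `y^(u) ε_S`: the Taylor part
`∑_{s ∈ S} ± (m_S / m_{S-s}) y^(u) ε_{S-s}` plus, for each `j` with `u_j > 0`, the homotopy part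
`∑_{t ∉ S} ± (f_{j,t} m_t m_S / m_{S ∪ t}) y^(u - e_j) ε_{S ∪ t}`. -/
def diffBasis (a : Fin c → MvPolynomial (Fin n) 𝕜) (μ : Fin r → (Fin n →₀ ℕ))
    (f : Fin c → Fin r → MvPolynomial (Fin n) 𝕜) (i : ℕ) (p : Label c r (i + 1)) :
    Term r a i :=
  (∑ s : {s // s ∈ p.1.2},
    Finsupp.single ⟨(p.1.1, p.1.2.erase s.1), label_erase p s.1 s.2⟩
      (sgn (CIRing a) s.1 p.1.2 *
        toCI a (MvPolynomial.monomial (lcmExp μ p.1.2 - lcmExp μ (p.1.2.erase s.1)) 1))) +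
  ∑ j : {j // 0 < p.1.1 j}, ∑ t : {t // t ∉ p.1.2},
    Finsupp.single ⟨(p.1.1 - Pi.single j.1 1, insert t.1 p.1.2), label_insert p j.1 j.2 t.1 t.2⟩
      (sgn (CIRing a) t.1 p.1.2 *
        toCI a (f j.1 t.1 * MvPolynomial.monomial
          (μ t.1 + lcmExp μ p.1.2 - lcmExp μ (insert t.1 p.1.2)) 1))

/-- The differential `Φ_{i+1} → Φ_i`. -/
def diff (a : Fin c → MvPolynomial (Fin n) 𝕜) (μ : Fin r → (Fin n →₀ ℕ))
    (f : Fin c → Fin r → MvPolynomial (Fin n) 𝕜) (i : ℕ) :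
    Term r a (i + 1) →ₗ[CIRing a] Term r a i :=
  Finsupp.linearCombination (CIRing a) (diffBasis a μ f i)

/-- The augmentation `Φ₀ → R/I`, sending the only basis element `ε_∅` to `1`. -/
def aug (a : Fin c → MvPolynomial (Fin n) 𝕜) (μ : Fin r → (Fin n →₀ ℕ)) :
    Term r a 0 →ₗ[CIRing a] QuotMod a μ :=
  Finsupp.linearCombination (CIRing a) (fun _ => (1 : QuotMod a μ))

end Resolution

end

end TaylorCI

/-! The engine is the calculus of creation and annihilation operators on functions on subsets of
`Fin r`. The sum of all annihilations is the boundary of the full simplex, and creation by any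
single vertex contracts it (`simplexD_cre`). Multiplying the coordinate at `T` by `m_T` embeds the
Taylor complex over `Q` into this simplex complex and turns `taylorH g` into the wedge with `∑ g_t
m_t e_t`. As `Q` is a domain the embedding is injective, so all identities pull back: with `δ` the
Taylor differential and `h_j = taylorH (f j)`, one has `δ² = 0`, `δ h_j + h_j δ = a_j`, `h_j² = 0`
and `h_i h_j + h_j h_i = 0`. In multidegree `α` the Taylor complex is the simplex on those `t` with
`m_t ∣ x^α`; this is a cone, whence exactness (`taylorD_exact`).

Let `χ_j` lower the exponent `u_j` by one. Then `d = δ + ∑ χ_j h_j` has `d² = ∑ a_j χ_j`, which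
vanishes over `R`; since the homotopies anticommute exactly, no higher homotopies are needed.
Exactness modulo `⟨a₁, …, a_k⟩` in nonzero degrees follows by adjoining one `a_j` at a time
(`shamash_step`, `totalD_exact`). All of this is done with lifts to `Q`, and `coords_diff` carries
it to `Φ` over `R`. Degree zero is checked by hand.

For the Betti bounds, Tor is a subquotient of `ResMod ⊗ Φ_i` (`rank_tor_le`), and `ResMod` is
spanned by `1` over `𝕜`. The ranks are counted by stars and bars. -/

namespace TaylorCI

noncomputable section

/-! ### Creation and annihilation operators and the full simplex. -/

section Fermions

variable {r : ℕ} {R : Type*} [CommRing R] {M : Type*} [AddCommGroup M] [Module R M]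

lemma sgn_mul_self (s : Fin r) (S : Finset (Fin r)) : sgn R s S * sgn R s S = 1 := by
  simp [sgn, ← mul_pow]

lemma sgn_insert {s t : Fin r} {S : Finset (Fin r)} (ht : t ∉ S) :
    sgn R s (insert t S) = (if s < t then -1 else 1) * sgn R s S := by
  unfold sgn
  rw [Finset.filter_insert]
  split_ifs with h
  · rw [Finset.card_insert_of_notMem (by simp [ht]), pow_succ, mul_comm]
  · rw [one_mul]

lemma sgn_erase {s t : Fin r} {S : Finset (Fin r)} (ht : t ∈ S) :
    sgn R s (S.erase t) = (if s < t then -1 else 1) * sgn R s S := by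
  conv_rhs => rw [← Finset.insert_erase ht, sgn_insert (Finset.notMem_erase t S)]
  split_ifs <;> simp

lemma sgn_insert_self (s : Fin r) (S : Finset (Fin r)) : sgn R s (insert s S) = sgn R s S := by
  by_cases h : s ∈ S
  · rw [Finset.insert_eq_of_mem h]
  · simp [sgn_insert h]

lemma sgn_erase_self (s : Fin r) (S : Finset (Fin r)) : sgn R s (S.erase s) = sgn R s S := by
  by_cases h : s ∈ S
  · simp [sgn_erase h]
  · rw [Finset.erase_eq_of_notMem h]

/-- Exactly one of `s < t` and `t < s` holds, so exactly one side picks up an extra `-1`. This is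
the source of every anticommutation relation below. -/
lemma sgn_swap {s t : Fin r} (hst : s ≠ t) (S : Finset (Fin r)) :
    sgn R t S * ((if s < t then -1 else 1) * sgn R s S) =
      -(sgn R s S * ((if t < s then -1 else 1) * sgn R t S)) := by
  rcases lt_or_gt_of_ne hst with h | h
  · simp [h, h.not_gt]; ring
  · simp [h, h.not_gt]; ring

variable (R M)

/-- Annihilation of the `s`-th generator on functions on subsets. -/
def ann (s : Fin r) : (Finset (Fin r) → M) →ₗ[R] (Finset (Fin r) → M) where
  toFun x T := if s ∈ T then 0 else sgn R s T • x (insert s T)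
  map_add' x y := by ext T; by_cases h : s ∈ T <;> simp [h]
  map_smul' q x := by ext T; by_cases h : s ∈ T <;> simp [h, smul_comm q]

/-- Creation of the `t`-th generator on functions on subsets. -/
def cre (t : Fin r) : (Finset (Fin r) → M) →ₗ[R] (Finset (Fin r) → M) where
  toFun x T := if t ∈ T then sgn R t T • x (T.erase t) else 0
  map_add' x y := by ext T; by_cases h : t ∈ T <;> simp [h]
  map_smul' q x := by ext T; by_cases h : t ∈ T <;> simp [h, smul_comm q]

variable {R M}

lemma ann_apply (s : Fin r) (x : Finset (Fin r) → M) (T : Finset (Fin r)) :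
    ann R M s x T = if s ∈ T then 0 else sgn R s T • x (insert s T) := rfl

lemma cre_apply (t : Fin r) (x : Finset (Fin r) → M) (T : Finset (Fin r)) :
    cre R M t x T = if t ∈ T then sgn R t T • x (T.erase t) else 0 := rfl

lemma ann_ann_self (s : Fin r) (x : Finset (Fin r) → M) : ann R M s (ann R M s x) = 0 := by
  ext T
  simp [ann_apply]

lemma cre_cre_self (s : Fin r) (x : Finset (Fin r) → M) : cre R M s (cre R M s x) = 0 := by
  ext T
  simp [cre_apply]

lemma ann_ann {s t : Fin r} (hst : s ≠ t) (x : Finset (Fin r) → M) :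
    ann R M s (ann R M t x) + ann R M t (ann R M s x) = 0 := by
  ext T
  by_cases hs : s ∈ T <;> by_cases ht : t ∈ T <;>
    simp [ann_apply, hs, ht, hst, hst.symm]
  rw [sgn_insert hs, sgn_insert ht, smul_smul, smul_smul, Finset.insert_comm s t,
    sgn_swap hst.symm, neg_smul, neg_add_cancel]

lemma cre_cre {s t : Fin r} (hst : s ≠ t) (x : Finset (Fin r) → M) :
    cre R M s (cre R M t x) + cre R M t (cre R M s x) = 0 := by
  ext T
  by_cases hs : s ∈ T <;> by_cases ht : t ∈ T <;>
    simp [cre_apply, hs, ht, hst, hst.symm]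
  rw [sgn_erase hs, sgn_erase ht, smul_smul, smul_smul, Finset.erase_right_comm,
    sgn_swap hst.symm, neg_smul, neg_add_cancel]

lemma ann_cre {s t : Fin r} (hst : s ≠ t) (x : Finset (Fin r) → M) :
    ann R M s (cre R M t x) + cre R M t (ann R M s x) = 0 := by
  ext T
  by_cases hs : s ∈ T <;> by_cases ht : t ∈ T <;>
    simp [ann_apply, cre_apply, hs, ht, hst, hst.symm]
  rw [sgn_insert hs, sgn_erase ht, smul_smul, smul_smul, Finset.erase_insert_of_ne hst,
    sgn_swap hst.symm, neg_smul, neg_add_cancel]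

lemma ann_cre_self (s : Fin r) (x : Finset (Fin r) → M) :
    ann R M s (cre R M s x) + cre R M s (ann R M s x) = x := by
  ext T
  by_cases hs : s ∈ T
  · simp [ann_apply, cre_apply, hs, smul_smul, sgn_erase_self, sgn_mul_self]
  · simp [ann_apply, cre_apply, hs, smul_smul, sgn_insert_self, sgn_mul_self]

/-- Swapping the two indices pairs off the terms. The diagonal is a separate hypothesis because `2 X
= 0` would not suffice in characteristic two. -/
lemma sum_sum_eq_zero_of_antisymm {ι A : Type*} [Fintype ι] [DecidableEq ι] [AddCommGroup A]
    (X : ι → ι → A) (h0 : ∀ s, X s s = 0) (h : ∀ s t, s ≠ t → X s t + X t s = 0) :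
    ∑ s, ∑ t, X s t = 0 := by
  rw [← Fintype.sum_prod_type']
  refine Finset.sum_involution (fun p _ => p.swap) ?_ ?_ ?_ ?_
  · rintro ⟨s, t⟩ -
    by_cases hst : s = t
    · subst hst; simp [h0]
    · exact h s t hst
  · rintro ⟨s, t⟩ - hX he
    simp only [Prod.swap_prod_mk, Prod.mk.injEq] at he
    exact hX (by simp [he.1, h0])
  · simp
  · simp

/-- The differential of the full simplex. -/
def simplexD : (Finset (Fin r) → M) →ₗ[R] (Finset (Fin r) → M) := ∑ s, ann R M s

/-- Multiplication by `∑ g_t e_t`. -/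
def wedge (g : Fin r → R) : (Finset (Fin r) → M) →ₗ[R] (Finset (Fin r) → M) :=
  ∑ t, g t • cre R M t

lemma simplexD_simplexD (x : Finset (Fin r) → M) :
    simplexD (R := R) (simplexD (R := R) x) = 0 := by
  simp only [simplexD, LinearMap.sum_apply, map_sum]
  exact sum_sum_eq_zero_of_antisymm _ (fun s => ann_ann_self s x) fun s t hst => ann_ann hst.symm x

lemma wedge_wedge_self (g : Fin r → R) (x : Finset (Fin r) → M) : wedge g (wedge g x) = 0 := by
  simp only [wedge, LinearMap.sum_apply, map_sum, LinearMap.smul_apply, map_smul, Finset.smul_sum]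
  refine sum_sum_eq_zero_of_antisymm _ (fun s => by simp [cre_cre_self]) fun s t hst => ?_
  rw [smul_comm (g t), ← smul_add, ← smul_add, cre_cre hst.symm, smul_zero, smul_zero]

lemma wedge_add (g g' : Fin r → R) (x : Finset (Fin r) → M) :
    wedge (g + g') x = wedge g x + wedge g' x := by
  simp [wedge, LinearMap.sum_apply, add_smul, Finset.sum_add_distrib]

/-- Polarization of `wedge_wedge_self` at `g + g'`. -/
lemma wedge_wedge (g g' : Fin r → R) (x : Finset (Fin r) → M) :
    wedge g (wedge g' x) + wedge g' (wedge g x) = 0 := by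
  have h := wedge_wedge_self (g + g') x
  simpa only [wedge_add, map_add, wedge_wedge_self, zero_add, add_zero, add_comm] using h

/-- The simplex is a cone with apex `t`: annihilators of other vertices anticommute with creation at
`t`, and only `s = t` contributes the identity. -/
lemma simplexD_cre (t : Fin r) (x : Finset (Fin r) → M) :
    simplexD (R := R) (cre R M t x) + cre R M t (simplexD (R := R) x) = x := by
  simp only [simplexD, LinearMap.sum_apply, map_sum]
  rw [← Finset.sum_add_distrib, Finset.sum_eq_single t (fun s _ hs => ann_cre hs x) (by simp),
    ann_cre_self]

lemma simplexD_wedge (g : Fin r → R) (x : Finset (Fin r) → M) :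
    simplexD (R := R) (wedge g x) + wedge g (simplexD (R := R) x) = (∑ t, g t) • x := by
  simp only [wedge, LinearMap.sum_apply, map_sum, LinearMap.smul_apply, map_smul]
  rw [← Finset.sum_add_distrib, Finset.sum_smul]
  refine Finset.sum_congr rfl fun t _ => ?_
  rw [← smul_add, simplexD_cre]

end Fermions

/-! ### Divisibility by monomials and projections to sets of monomials. -/

section MonomialFilter

variable {𝕜 σ : Type*} [Field 𝕜]

lemma monomial_one_dvd_iff (s : σ →₀ ℕ) (q : MvPolynomial σ 𝕜) :
    MvPolynomial.monomial s 1 ∣ q ↔ ∀ α, q.coeff α ≠ 0 → s ≤ α := by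
  rw [MvPolynomial.monomial_one_dvd_iff_modMonomial_eq_zero, MvPolynomial.ext_iff]
  refine forall_congr' fun α => ?_
  by_cases h : s ≤ α
  · simp [h, MvPolynomial.coeff_modMonomial_of_le]
  · simp [h, MvPolynomial.coeff_modMonomial_of_not_le]

open Classical in
/-- The projection of polynomials to the span of the monomials whose exponent satisfies `P`. -/
def monFilter (P : (σ →₀ ℕ) → Prop) : MvPolynomial σ 𝕜 →ₗ[𝕜] MvPolynomial σ 𝕜 :=
  (MvPolynomial.basisMonomials σ 𝕜).constr 𝕜
    fun α => if P α then MvPolynomial.monomial α 1 else 0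

open Classical in
lemma coeff_monFilter (P : (σ →₀ ℕ) → Prop) (q : MvPolynomial σ 𝕜) (α : σ →₀ ℕ) :
    (monFilter P q).coeff α = if P α then q.coeff α else 0 := by
  have h : ∀ β, monFilter (𝕜 := 𝕜) P (MvPolynomial.monomial β 1) =
      if P β then MvPolynomial.monomial β 1 else 0 := fun β =>
    (MvPolynomial.basisMonomials σ 𝕜).constr_basis 𝕜 _ β
  induction q using MvPolynomial.induction_on' with
  | monomial β b =>
    rw [← mul_one b, ← smul_eq_mul, ← MvPolynomial.smul_monomial, map_smul, h]
    by_cases hβ : β = α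
    · subst hβ
      split_ifs <;> simp
    · split_ifs <;> simp [hβ]
  | add p q hp hq => rw [map_add, MvPolynomial.coeff_add, hp, hq]; split_ifs <;> simp

end MonomialFilter

/-! ### The Taylor complex, its homotopies and its exactness. -/

section Taylor

variable {𝕜 : Type u} [Field 𝕜] {n r : ℕ} (μ : Fin r → (Fin n →₀ ℕ))
  (M : Type*) [AddCommGroup M] [Module (MvPolynomial (Fin n) 𝕜) M]

/-- The differential of the Taylor complex with coefficients in `M`, on coordinates. -/
def taylorD : (Finset (Fin r) → M) →ₗ[MvPolynomial (Fin n) 𝕜] (Finset (Fin r) → M) where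
  toFun x T := ∑ s, if s ∈ T then 0 else (sgn (MvPolynomial (Fin n) 𝕜) s T *
    MvPolynomial.monomial (lcmExp μ (insert s T) - lcmExp μ T) 1) • x (insert s T)
  map_add' x y := by
    ext T
    rw [Pi.add_apply, ← Finset.sum_add_distrib]
    refine Finset.sum_congr rfl fun s _ => ?_
    split_ifs <;> simp
  map_smul' q x := by
    ext T
    rw [RingHom.id_apply, Pi.smul_apply, Finset.smul_sum]
    refine Finset.sum_congr rfl fun s _ => ?_
    split_ifs
    · simp
    · rw [Pi.smul_apply, smul_comm]

/-- Multiplication by `∑ g_t ε_t` on the Taylor complex with coefficients in `M`, on coordinates. -/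
def taylorH (g : Fin r → MvPolynomial (Fin n) 𝕜) :
    (Finset (Fin r) → M) →ₗ[MvPolynomial (Fin n) 𝕜] (Finset (Fin r) → M) where
  toFun x T := ∑ t, if t ∈ T then (sgn (MvPolynomial (Fin n) 𝕜) t T * (g t *
    MvPolynomial.monomial (μ t + lcmExp μ (T.erase t) - lcmExp μ T) 1)) • x (T.erase t) else 0
  map_add' x y := by
    ext T
    rw [Pi.add_apply, ← Finset.sum_add_distrib]
    refine Finset.sum_congr rfl fun s _ => ?_
    split_ifs <;> simp
  map_smul' q x := by
    ext T
    rw [RingHom.id_apply, Pi.smul_apply, Finset.smul_sum]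
    refine Finset.sum_congr rfl fun s _ => ?_
    split_ifs
    · rw [Pi.smul_apply, smul_comm]
    · simp

/-- The rescaling that takes the Taylor complex into the complex of the full simplex. -/
def lcmScale : (Finset (Fin r) → M) →ₗ[MvPolynomial (Fin n) 𝕜] (Finset (Fin r) → M) where
  toFun x T := MvPolynomial.monomial (lcmExp μ T) (1 : 𝕜) • x T
  map_add' x y := by ext; simp
  map_smul' q x := by ext; simp [smul_comm q]

variable {M}

lemma taylorD_apply (x : Finset (Fin r) → M) (T : Finset (Fin r)) :
    taylorD (𝕜 := 𝕜) μ M x T =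
      ∑ s, if s ∈ T then 0 else (sgn (MvPolynomial (Fin n) 𝕜) s T *
        MvPolynomial.monomial (lcmExp μ (insert s T) - lcmExp μ T) 1) • x (insert s T) := rfl

lemma taylorH_apply (g : Fin r → MvPolynomial (Fin n) 𝕜) (x : Finset (Fin r) → M)
    (T : Finset (Fin r)) :
    taylorH μ M g x T =
      ∑ t, if t ∈ T then (sgn (MvPolynomial (Fin n) 𝕜) t T * (g t *
        MvPolynomial.monomial (μ t + lcmExp μ (T.erase t) - lcmExp μ T) 1)) • x (T.erase t)
        else 0 := rfl

lemma lcmScale_apply (x : Finset (Fin r) → M) (T : Finset (Fin r)) :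
    lcmScale (𝕜 := 𝕜) μ M x T = MvPolynomial.monomial (lcmExp μ T) (1 : 𝕜) • x T := rfl

lemma lcmScale_taylorD (x : Finset (Fin r) → M) :
    lcmScale (𝕜 := 𝕜) μ M (taylorD (𝕜 := 𝕜) μ M x) =
      simplexD (R := MvPolynomial (Fin n) 𝕜) (lcmScale (𝕜 := 𝕜) μ M x) := by
  ext T
  simp only [lcmScale_apply, taylorD_apply, simplexD, LinearMap.sum_apply, Finset.sum_apply,
    ann_apply, Finset.smul_sum]
  refine Finset.sum_congr rfl fun s _ => ?_
  split_ifs with h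
  · simp
  · have hle : lcmExp μ T ≤ lcmExp μ (insert s T) := Finset.sup_mono (Finset.subset_insert s T)
    rw [smul_smul, smul_smul, mul_left_comm, MvPolynomial.monomial_mul,
      add_tsub_cancel_of_le hle, one_mul]

lemma lcmScale_taylorH (g : Fin r → MvPolynomial (Fin n) 𝕜) (x : Finset (Fin r) → M) :
    lcmScale (𝕜 := 𝕜) μ M (taylorH μ M g x) =
      wedge (fun t => g t * MvPolynomial.monomial (μ t) 1) (lcmScale (𝕜 := 𝕜) μ M x) := by
  ext T
  simp only [lcmScale_apply, taylorH_apply, wedge, LinearMap.sum_apply, Finset.sum_apply,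
    LinearMap.smul_apply, Pi.smul_apply, cre_apply, Finset.smul_sum]
  refine Finset.sum_congr rfl fun t _ => ?_
  split_ifs with h
  · have hle : lcmExp μ T ≤ μ t + lcmExp μ (T.erase t) := by
      conv_lhs => rw [← Finset.insert_erase h, lcmExp, Finset.sup_insert]
      exact sup_le le_self_add le_add_self
    rw [smul_smul, smul_smul, smul_smul]
    congr 1
    have e : MvPolynomial.monomial (lcmExp μ T) (1 : 𝕜) *
        MvPolynomial.monomial (μ t + lcmExp μ (T.erase t) - lcmExp μ T) 1 =
        MvPolynomial.monomial (μ t) 1 * MvPolynomial.monomial (lcmExp μ (T.erase t)) 1 := by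
      rw [MvPolynomial.monomial_mul, MvPolynomial.monomial_mul, add_tsub_cancel_of_le hle]
    linear_combination (sgn (MvPolynomial (Fin n) 𝕜) t T * g t) * e
  · simp

local notation "Q" => MvPolynomial (Fin n) 𝕜

lemma lcmScale_injective : Function.Injective (lcmScale (𝕜 := 𝕜) (r := r) μ Q) := by
  intro x y h
  ext1 T
  have hT := congrFun h T
  simp only [lcmScale_apply, smul_eq_mul] at hT
  exact mul_left_cancel₀ (by simp [MvPolynomial.monomial_eq_zero]) hT

lemma taylorD_taylorD (x : Finset (Fin r) → Q) :
    taylorD (𝕜 := 𝕜) μ Q (taylorD (𝕜 := 𝕜) μ Q x) = 0 :=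
  lcmScale_injective μ (by rw [lcmScale_taylorD, lcmScale_taylorD, simplexD_simplexD, map_zero])

lemma taylorH_taylorH_self (g : Fin r → Q) (x : Finset (Fin r) → Q) :
    taylorH μ Q g (taylorH μ Q g x) = 0 :=
  lcmScale_injective μ (by rw [lcmScale_taylorH, lcmScale_taylorH, wedge_wedge_self, map_zero])

lemma taylorH_taylorH (g g' : Fin r → Q) (x : Finset (Fin r) → Q) :
    taylorH μ Q g (taylorH μ Q g' x) + taylorH μ Q g' (taylorH μ Q g x) = 0 :=
  lcmScale_injective μ (by simp only [map_add, lcmScale_taylorH, wedge_wedge, map_zero])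

lemma taylorD_taylorH (g : Fin r → Q) (x : Finset (Fin r) → Q) :
    taylorD (𝕜 := 𝕜) μ Q (taylorH μ Q g x) + taylorH μ Q g (taylorD (𝕜 := 𝕜) μ Q x) =
      (∑ t, g t * MvPolynomial.monomial (μ t) 1) • x :=
  lcmScale_injective μ (by
    simp only [map_add, lcmScale_taylorH, lcmScale_taylorD, simplexD_wedge, map_smul])

/-- The simplex boundary involves only signs, so maps that are merely `𝕜`-linear, such as
projections to sets of monomials, commute with it. -/
lemma simplexD_comp (F : Q →ₗ[𝕜] Q) (x : Finset (Fin r) → Q) :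
    simplexD (R := Q) (fun T => F (x T)) = fun T => F (simplexD (R := Q) x T) := by
  ext1 T
  simp only [simplexD, LinearMap.sum_apply, Finset.sum_apply, ann_apply, map_sum]
  refine Finset.sum_congr rfl fun s _ => ?_
  split_ifs
  · simp
  · rcases neg_one_pow_eq_or Q (T.filter (fun t => s < t)).card with h | h <;> simp [sgn, h]

/-- The Taylor complex is exact in positive degrees. -/
theorem taylorD_exact {i : ℕ} (hi : i ≠ 0) (x : Finset (Fin r) → Q)
    (hx : ∀ T, T.card ≠ i → x T = 0) (hdx : taylorD (𝕜 := 𝕜) μ Q x = 0) :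
    ∃ y : Finset (Fin r) → Q, (∀ T, T.card ≠ i + 1 → y T = 0) ∧ taylorD (𝕜 := 𝕜) μ Q y = x := by
  classical
  -- The apex of the cone in multidegree `α`: some generator dividing `x^α`, if there is one.
  let pick : (Fin n →₀ ℕ) → Option (Fin r) := fun α =>
    if h : ∃ t, μ t ≤ α then some h.choose else none
  have pick_le : ∀ α t, pick α = some t → μ t ≤ α := by
    intro α t h
    by_cases h' : ∃ t, μ t ≤ α
    · simp only [pick, dif_pos h', Option.some.injEq] at h
      exact h ▸ h'.choose_spec
    · simp [pick, h'] at h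
  let F : Fin r → Q →ₗ[𝕜] Q := fun t => monFilter fun α => pick α = some t
  let X := lcmScale (𝕜 := 𝕜) μ Q x
  have hX : simplexD (R := Q) X = 0 := by rw [← lcmScale_taylorD, hdx, map_zero]
  have hXc : ∀ T α, (X T).coeff α ≠ 0 → lcmExp μ T ≤ α := fun T =>
    (monomial_one_dvd_iff _ _).1 ⟨x T, rfl⟩
  have hX0 : ∀ T, T.card ≠ i → X T = 0 := fun T hT => by
    simp [X, lcmScale_apply, hx T hT]
  -- Here `i ≠ 0` enters: a monomial occurring in `X T` is divisible by `m_t` for any `t ∈ T`, so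
  -- `T` nonempty guarantees an apex.
  have hsum : ∀ T, ∑ t, F t (X T) = X T := by
    intro T
    by_cases hT : T.card = i
    · ext α
      simp only [MvPolynomial.coeff_sum, F, coeff_monFilter]
      by_cases h0 : (X T).coeff α = 0
      · simp [h0]
      · obtain ⟨t, ht⟩ := Finset.card_pos.1 (Nat.pos_of_ne_zero (hT ▸ hi))
        have hex : ∃ t, μ t ≤ α := ⟨t, (Finset.le_sup ht).trans (hXc T α h0)⟩
        rw [Finset.sum_eq_single hex.choose]
        · simp [pick, hex]
        · intro b _ hb
          simp [pick, hex, hb.symm]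
        · simp
    · simp [hX0 T hT]
  -- Each monomial part of `X` is coned off with its own apex.
  let Y : Finset (Fin r) → Q := ∑ t, cre Q Q t fun T => F t (X T)
  have hYapp : ∀ T, Y T = ∑ t, if t ∈ T then sgn Q t T • F t (X (T.erase t)) else 0 := by
    intro T
    simp only [Y, Finset.sum_apply, cre_apply]
  have hYd : simplexD (R := Q) Y = X := by
    have : ∀ t, simplexD (R := Q) (cre Q Q t fun T => F t (X T)) = fun T => F t (X T) := by
      intro t
      have h := simplexD_cre (R := Q) t fun T => F t (X T)
      rw [simplexD_comp, hX] at h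
      simpa [← Pi.zero_def] using h
    simp only [Y, map_sum, this]
    ext1 T
    rw [Finset.sum_apply, hsum]
  -- A monomial entering through apex `t` is divisible by both `m_t` and `m_{T∖t}`, hence by `m_T`;
  -- so `Y` comes from the Taylor complex.
  have hYdvd : ∀ T, MvPolynomial.monomial (lcmExp μ T) (1 : 𝕜) ∣ Y T := by
    intro T
    rw [hYapp]
    refine Finset.dvd_sum fun t _ => ?_
    split_ifs with ht
    · refine Dvd.dvd.mul_left ?_ _
      rw [monomial_one_dvd_iff]
      intro α hα
      simp only [F, coeff_monFilter] at hα
      split_ifs at hα with hp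
      · rw [← Finset.insert_erase ht, lcmExp, Finset.sup_insert]
        exact sup_le (pick_le α t hp) (hXc _ _ hα)
      · exact absurd rfl hα
    · exact dvd_zero _
  choose y hy using hYdvd
  have hyY : lcmScale (𝕜 := 𝕜) μ Q y = Y := by
    ext1 T
    rw [hy T, lcmScale_apply, smul_eq_mul]
  refine ⟨y, fun T hT => ?_, lcmScale_injective μ (by rw [lcmScale_taylorD, hyY, hYd])⟩
  have hYT : Y T = 0 := by
    rw [hYapp]
    refine Finset.sum_eq_zero fun t _ => ?_
    split_ifs with ht
    · rw [hX0 _ (by have := Finset.card_erase_add_one ht; omega), map_zero, smul_zero]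
    · rfl
  rw [hy T, mul_eq_zero] at hYT
  exact hYT.resolve_left (by simp [MvPolynomial.monomial_eq_zero])

end Taylor

/-! ### Adjoining one regular element. -/

section OneStep

variable {V : Type*} [AddCommGroup V] (deg : ℤ → AddSubgroup V) (N N' : AddSubgroup V)
  (D h A : V →+ V)

/-- One step of the Eisenbud–Shamash construction, on lifts: `D` is a differential modulo `N`,
exact in nonzero degrees, `h` is a homotopy for the regular element `A`, and `N' = N + A V`. -/
theorem shamash_step
    (hneg : ∀ i < 0, ∀ v ∈ deg i, v = 0)
    (hDdeg : ∀ i, ∀ v ∈ deg i, D v ∈ deg (i - 1)) (hhdeg : ∀ i, ∀ v ∈ deg i, h v ∈ deg (i + 1))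
    (hDN : ∀ v ∈ N, D v ∈ N)
    (hhN' : ∀ v ∈ N', h v ∈ N')
    (hDD : ∀ v, D (D v) ∈ N) (hDh : ∀ v, D (h v) + h (D v) = A v) (hhh : ∀ v, h (h v) = 0)
    (hhN : ∀ v ∈ N, h v ∈ N)
    (hreg : ∀ v, A v ∈ N → v ∈ N) (hNN' : N ≤ N') (hA : ∀ v, A v ∈ N')
    (hN' : ∀ i, ∀ v ∈ deg i, v ∈ N' → ∃ w ∈ deg i, v - A w ∈ N)
    (hex : ∀ i ≠ 0, ∀ z ∈ deg i, D z ∈ N → ∃ u ∈ deg (i + 1), z - D u ∈ N)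
    {i : ℤ} (hi : i ≠ 0) (L : ℕ) (z : ℕ → V) (hz : ∀ l : ℕ, z l ∈ deg (i - 2 * l))
    (hL : ∀ l ≥ L, z l ∈ N') (hcyc : ∀ l, D (z l) + h (z (l + 1)) ∈ N') :
    ∃ u : ℕ → V, (∀ l : ℕ, u l ∈ deg (i + 1 - 2 * l)) ∧
      ∀ l, z l - (D (u l) + h (u (l + 1))) ∈ N' := by
  induction L generalizing z with
  | zero => exact ⟨0, fun l => zero_mem _, fun l => by simpa using hL l (Nat.zero_le l)⟩
  | succ L ih =>
    -- Subtracting the boundary of `c` kills the top component `z L` modulo `N'`. The result is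
    -- again a cycle modulo `N'`, as the total differential squares to zero there, so induction on
    -- `L` applies.
    suffices H : ∃ c : ℕ → V, (∀ l : ℕ, c l ∈ deg (i + 1 - 2 * l)) ∧
        ∀ l ≥ L, z l - (D (c l) + h (c (l + 1))) ∈ N' by
      obtain ⟨c, hc, hcL⟩ := H
      have hz' : ∀ l : ℕ, z l - (D (c l) + h (c (l + 1))) ∈ deg (i - 2 * l) := by
        refine fun l => sub_mem (hz l) (add_mem ?_ ?_)
        · convert hDdeg _ _ (hc l) using 2
          ring
        · convert hhdeg _ _ (hc (l + 1)) using 2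
          push_cast
          ring
      have hcyc' : ∀ l : ℕ, D (z l - (D (c l) + h (c (l + 1)))) + h (z (l + 1) -
            (D (c (l + 1)) + h (c (l + 1 + 1)))) ∈ N' := by
        intro l
        have e : D (z l - (D (c l) + h (c (l + 1)))) + h (z (l + 1) -
            (D (c (l + 1)) + h (c (l + 1 + 1)))) =
            (D (z l) + h (z (l + 1))) - (D (D (c l)) + A (c (l + 1))) := by
          simp only [map_sub, map_add, hhh, ← hDh]
          abel
        rw [e]
        exact sub_mem (hcyc l) (add_mem (hNN' (hDD _)) (hA _))
      obtain ⟨u, hu, hu'⟩ := ih _ hz' hcL hcyc'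
      refine ⟨u + c, fun l => add_mem (hu l) (hc l), fun l => ?_⟩
      have := hu' l
      simp only [Pi.add_apply, map_add] at this ⊢
      convert this using 1
      abel
    have hDzL : D (z L) ∈ N' := by
      have := sub_mem (hcyc L) (hhN' _ (hL (L + 1) (by omega)))
      simpa using this
    have hcomm : ∀ w, D (A w) - A (D w) ∈ N := by
      intro w
      rw [← hDh w, ← hDh (D w), map_add]
      have := sub_mem (hDD (h w)) (hhN _ (hDD w))
      convert this using 1
      abel
    -- If `z L` has degree zero, exactness is not available. The cycle condition one index lower
    -- replaces it: write `D z_K + h z_{K+1} = A w` modulo `N`, apply `D` to get `A z_{K+1} = A (D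
    -- w)`, and cancel `A`.
    by_cases h0 : i - 2 * L = 0
    · obtain ⟨K, rfl⟩ : ∃ K, L = K + 1 := Nat.exists_eq_succ_of_ne_zero (by
        rintro rfl
        simp at h0
        exact hi h0)
      have hDz0 : D (z (K + 1)) = 0 :=
        hneg _ (by omega) _ (hDdeg _ _ (hz (K + 1)))
      obtain ⟨w, hw, hwN⟩ := hN' 1 (D (z K) + h (z (K + 1))) (add_mem
        (by convert hDdeg _ _ (hz K) using 2; push_cast at h0; omega)
        (by convert hhdeg _ _ (hz (K + 1)) using 2; omega)) (hcyc K)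
      have hzw : z (K + 1) - D w ∈ N := by
        apply hreg
        have h1 := hDN _ hwN
        have h2 := hDh (z (K + 1))
        rw [hDz0, map_zero, add_zero] at h2
        rw [map_sub, map_add, h2] at h1
        rw [map_sub]
        have := add_mem (sub_mem h1 (hDD (z K))) (hcomm w)
        convert this using 1
        abel
      refine ⟨Pi.single (K + 1) w, fun l => ?_, fun l hl => ?_⟩
      · by_cases hl : l = K + 1
        · subst hl
          simp only [Pi.single_eq_same]
          convert hw using 2
          omega
        · simp [hl, zero_mem]
      · by_cases hl' : l = K + 1
        · subst hl'
          simpa using hNN' hzw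
        · have : l ≠ K := by omega
          simpa [hl', this] using hL l (by omega)
    -- Write `D z_L = A w` modulo `N`. Cancelling `A` in `A (D w) = D (D z_L) = 0` gives `D w = 0`
    -- modulo `N`, so `z_L - h w` is a cycle and equals some `D v`. The correction is `v` at `L` and
    -- `w` at `L + 1`.
    · obtain ⟨w, hw, hwN⟩ := hN' _ (D (z L)) (hDdeg _ _ (hz L)) hDzL
      have hDw : D w ∈ N := by
        apply hreg
        have := sub_mem (sub_mem (hDD (z L)) (hDN _ hwN)) (hcomm w)
        rw [map_sub] at this
        convert this using 1
        abel
      obtain ⟨v, hv, hvN⟩ := hex _ h0 (z L - h w)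
        (sub_mem (hz L) (by convert hhdeg _ _ hw using 2; ring)) (by
          have := add_mem hwN (hhN _ hDw)
          rw [← hDh w] at this
          rw [map_sub]
          convert this using 1
          abel)
      refine ⟨Pi.single L v + Pi.single (L + 1) w, fun l => ?_, fun l hl => ?_⟩
      · refine add_mem ?_ ?_
        · by_cases hl : l = L
          · subst hl
            simp only [Pi.single_eq_same]
            convert hv using 2
            ring
          · simp [hl, zero_mem]
        · by_cases hl : l = L + 1
          · subst hl
            simp only [Pi.single_eq_same]
            convert hw using 2
            push_cast
            ring
          · simp [hl, zero_mem]
      · rcases eq_or_ne l L with rfl | hl1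
        · simp only [Pi.add_apply, Pi.single_eq_same, ne_eq, Nat.add_eq_left, one_ne_zero,
            not_false_eq_true, Pi.single_eq_of_ne, Nat.left_eq_add, add_zero, zero_add]
          have := hNN' hvN
          convert this using 1
          abel
        · rcases eq_or_ne l (L + 1) with rfl | hl2
          · simpa [show L + 1 + 1 ≠ L by omega] using sub_mem (hL (L + 1) le_rfl) (hNN' hDw)
          · have h3 : l + 1 ≠ L := by omega
            simpa [hl1, hl2, h3] using hL l (by omega)

end OneStep

/-! ### The Eisenbud–Shamash complex, by induction on the number of relations. -/

section Total

variable {𝕜 : Type u} [Field 𝕜] {n r : ℕ} (μ : Fin r → (Fin n →₀ ℕ))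
  (M : Type*) [AddCommGroup M] [Module (MvPolynomial (Fin n) 𝕜) M]

local notation "Q" => MvPolynomial (Fin n) 𝕜

/-- The operator `taylorD + ∑ⱼ χⱼ · taylorH (f j)` on coordinates indexed by pairs `(u, S)`. -/
def totalD {k : ℕ} (f : Fin k → Fin r → Q) :
    ((Fin k → ℕ) → Finset (Fin r) → M) →ₗ[Q] ((Fin k → ℕ) → Finset (Fin r) → M) where
  toFun z u := taylorD (𝕜 := 𝕜) μ M (z u) + ∑ j, taylorH μ M (f j) (z (u + Pi.single j 1))
  map_add' x y := by
    ext1 u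
    simp only [Pi.add_apply, map_add, Finset.sum_add_distrib]
    abel
  map_smul' q x := by
    ext1 u
    simp only [Pi.smul_apply, map_smul, smul_add, Finset.smul_sum, RingHom.id_apply]

/-- `taylorH g` acting on each component. -/
def totalH (k : ℕ) (g : Fin r → Q) :
    ((Fin k → ℕ) → Finset (Fin r) → M) →ₗ[Q] ((Fin k → ℕ) → Finset (Fin r) → M) where
  toFun z u := taylorH μ M g (z u)
  map_add' x y := by ext1 u; simp
  map_smul' q x := by ext1 u; simp

/-- Families of coordinates that are homogeneous of homological degree `i`. -/
def totalDeg (r : ℕ) (k : ℕ) (i : ℤ) : AddSubgroup ((Fin k → ℕ) → Finset (Fin r) → M) where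
  carrier := {z | ∀ u S, ((2 * ∑ j, u j + S.card : ℕ) : ℤ) ≠ i → z u S = 0}
  zero_mem' := by simp
  add_mem' hx hy u S h := by simp [hx u S h, hy u S h]
  neg_mem' hx u S h := by simp [hx u S h]

/-- Families of coordinates with values in the submodule `J`. -/
def coordsIn (r k : ℕ) (J : Submodule Q M) : AddSubgroup ((Fin k → ℕ) → Finset (Fin r) → M) where
  carrier := {z | ∀ u S, z u S ∈ J}
  zero_mem' := by simp
  add_mem' hx hy u S := add_mem (hx u S) (hy u S)
  neg_mem' hx u S := neg_mem (hx u S)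

variable {M}

lemma totalD_apply {k : ℕ} (f : Fin k → Fin r → Q) (z : (Fin k → ℕ) → Finset (Fin r) → M)
    (u : Fin k → ℕ) : totalD μ M f z u =
      taylorD (𝕜 := 𝕜) μ M (z u) + ∑ j, taylorH μ M (f j) (z (u + Pi.single j 1)) := rfl

lemma totalH_apply {k : ℕ} (g : Fin r → Q) (z : (Fin k → ℕ) → Finset (Fin r) → M)
    (u : Fin k → ℕ) : totalH μ M k g z u = taylorH μ M g (z u) := rfl

lemma taylorD_mem {J : Submodule Q M} {x : Finset (Fin r) → M} (hx : ∀ S, x S ∈ J)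
    (S : Finset (Fin r)) : taylorD (𝕜 := 𝕜) μ M x S ∈ J := by
  rw [taylorD_apply]
  refine sum_mem fun s _ => ?_
  split_ifs
  · exact zero_mem _
  · exact J.smul_mem _ (hx _)

lemma taylorH_mem (g : Fin r → Q) {J : Submodule Q M} {x : Finset (Fin r) → M}
    (hx : ∀ S, x S ∈ J) (S : Finset (Fin r)) : taylorH μ M g x S ∈ J := by
  rw [taylorH_apply]
  refine sum_mem fun s _ => ?_
  split_ifs
  · exact J.smul_mem _ (hx _)
  · exact zero_mem _

lemma totalD_mem {k : ℕ} (f : Fin k → Fin r → Q) {J : Submodule Q M}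
    {z : (Fin k → ℕ) → Finset (Fin r) → M} (hz : z ∈ coordsIn M r k J) :
    totalD μ M f z ∈ coordsIn M r k J := by
  intro u S
  rw [totalD_apply, Pi.add_apply, Finset.sum_apply]
  exact add_mem (taylorD_mem μ (hz u) S) (sum_mem fun j _ => taylorH_mem μ _ (hz _) S)

lemma totalH_mem {k : ℕ} (g : Fin r → Q) {J : Submodule Q M}
    {z : (Fin k → ℕ) → Finset (Fin r) → M} (hz : z ∈ coordsIn M r k J) :
    totalH μ M k g z ∈ coordsIn M r k J :=
  fun u S => taylorH_mem μ g (hz u) S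

lemma taylorD_eq_zero {x : Finset (Fin r) → M} {S : Finset (Fin r)}
    (hx : ∀ T : Finset (Fin r), T.card = S.card + 1 → x T = 0) :
    taylorD (𝕜 := 𝕜) μ M x S = 0 := by
  rw [taylorD_apply]
  refine Finset.sum_eq_zero fun s _ => ?_
  split_ifs with h
  · rfl
  · rw [hx _ (Finset.card_insert_of_notMem h), smul_zero]

lemma taylorH_eq_zero (g : Fin r → Q) {x : Finset (Fin r) → M} {S : Finset (Fin r)}
    (hx : ∀ T : Finset (Fin r), T.card + 1 = S.card → x T = 0) :
    taylorH μ M g x S = 0 := by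
  rw [taylorH_apply]
  refine Finset.sum_eq_zero fun s _ => ?_
  split_ifs with h
  · rw [hx _ (Finset.card_erase_add_one h), smul_zero]
  · rfl

lemma sum_add_single {k : ℕ} (u : Fin k → ℕ) (j : Fin k) :
    ∑ l, (u + (Pi.single j 1 : Fin k → ℕ)) l = ∑ l, u l + 1 := by
  simp [Finset.sum_add_distrib]

lemma totalD_deg {k : ℕ} (f : Fin k → Fin r → Q) {i : ℤ}
    {z : (Fin k → ℕ) → Finset (Fin r) → M} (hz : z ∈ totalDeg M r k i) :
    totalD μ M f z ∈ totalDeg M r k (i - 1) := by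
  intro u S h
  rw [totalD_apply, Pi.add_apply, Finset.sum_apply, taylorD_eq_zero μ, zero_add]
  · refine Finset.sum_eq_zero fun j _ => taylorH_eq_zero μ _ fun T hT => hz _ _ ?_
    rw [sum_add_single]
    omega
  · refine fun T hT => hz _ _ ?_
    omega

lemma totalH_deg {k : ℕ} (g : Fin r → Q) {i : ℤ}
    {z : (Fin k → ℕ) → Finset (Fin r) → M} (hz : z ∈ totalDeg M r k i) :
    totalH μ M k g z ∈ totalDeg M r k (i + 1) :=
  fun u S h => taylorH_eq_zero μ _ fun T hT => hz _ _ (by omega)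

lemma totalDeg_neg {k : ℕ} {i : ℤ} (hi : i < 0) {z : (Fin k → ℕ) → Finset (Fin r) → M}
    (hz : z ∈ totalDeg M r k i) : z = 0 := by
  ext u S
  exact hz u S (by omega)

lemma totalH_totalH_self {k : ℕ} (g : Fin r → Q) (z : (Fin k → ℕ) → Finset (Fin r) → Q) :
    totalH μ Q k g (totalH μ Q k g z) = 0 := by
  ext1 u
  exact taylorH_taylorH_self μ g (z u)

lemma totalD_totalH {k : ℕ} (f : Fin k → Fin r → Q) (g : Fin r → Q)
    (z : (Fin k → ℕ) → Finset (Fin r) → Q) :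
    totalD μ Q f (totalH μ Q k g z) + totalH μ Q k g (totalD μ Q f z) =
      (∑ t, g t * MvPolynomial.monomial (μ t) 1) • z := by
  ext1 u
  simp only [Pi.add_apply, totalD_apply, totalH_apply, map_add, map_sum, Pi.smul_apply]
  rw [← taylorD_taylorH, add_add_add_comm, ← Finset.sum_add_distrib,
    Finset.sum_eq_zero fun j _ => taylorH_taylorH μ _ _ _, add_zero]

lemma snoc_add_single_castSucc {k : ℕ} (u : Fin k → ℕ) (l : ℕ) (j : Fin k) :
    (Fin.snoc u l : Fin (k + 1) → ℕ) + Pi.single j.castSucc 1 =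
      (Fin.snoc (u + Pi.single j 1) l : Fin (k + 1) → ℕ) := by
  ext i
  refine Fin.lastCases ?_ (fun i => ?_) i
  · simp [(Fin.castSucc_lt_last j).ne']
  · simp [Pi.single_apply]

lemma snoc_add_single_last {k : ℕ} (u : Fin k → ℕ) (l : ℕ) :
    (Fin.snoc u l : Fin (k + 1) → ℕ) + Pi.single (Fin.last k) 1 =
      (Fin.snoc u (l + 1) : Fin (k + 1) → ℕ) := by
  ext i
  refine Fin.lastCases ?_ (fun i => ?_) i
  · simp
  · simp [(Fin.castSucc_lt_last i).ne]

lemma totalD_snoc {k : ℕ} (f : Fin (k + 1) → Fin r → Q)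
    (z : (Fin (k + 1) → ℕ) → Finset (Fin r) → M) (u : Fin k → ℕ) (l : ℕ) :
    totalD μ M f z (Fin.snoc u l) =
      totalD μ M (fun j => f j.castSucc) (fun v => z (Fin.snoc v l)) u +
        totalH μ M k (f (Fin.last k)) (fun v => z (Fin.snoc v (l + 1))) u := by
  simp only [totalD_apply, totalH_apply, Fin.sum_univ_castSucc, snoc_add_single_castSucc,
    snoc_add_single_last, add_assoc]

lemma totalDeg_snoc {k : ℕ} {i : ℤ} {z : (Fin (k + 1) → ℕ) → Finset (Fin r) → M}
    (hz : z ∈ totalDeg M r (k + 1) i) (l : ℕ) :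
    (fun v => z (Fin.snoc v l)) ∈ totalDeg M r k (i - 2 * l) := by
  intro u S h
  refine hz _ _ ?_
  rw [Fin.sum_univ_castSucc]
  simp only [Fin.snoc_castSucc, Fin.snoc_last]
  intro h'
  apply h
  push_cast at h' ⊢
  linarith

lemma span_range_succ {k : ℕ} (a : Fin (k + 1) → Q) :
    Ideal.span (Set.range a) =
      Ideal.span (Set.range fun j : Fin k => a j.castSucc) ⊔ Ideal.span {a (Fin.last k)} := by
  rw [← Ideal.span_union]
  congr 1
  ext x
  constructor
  · rintro ⟨i, rfl⟩
    refine Fin.lastCases (Or.inr rfl) (fun i => Or.inl ⟨i, rfl⟩) i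
  · rintro (⟨i, rfl⟩ | rfl)
    · exact ⟨_, rfl⟩
    · exact ⟨_, rfl⟩

/-- The Eisenbud–Shamash construction on the Taylor complex, on lifts to the polynomial ring:
`totalD` squares to zero modulo `⟨a₁, …, a_k⟩` and is exact modulo that ideal in nonzero
degrees. -/
theorem totalD_exact {k : ℕ} (a : Fin k → Q) (f : Fin k → Fin r → Q)
    (haf : ∀ i, a i = ∑ t, f i t * MvPolynomial.monomial (μ t) 1)
    (hreg : ∀ j x, a j * x ∈ Ideal.span (a '' {i | i < j}) → x ∈ Ideal.span (a '' {i | i < j})) :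
    (∀ z, totalD μ Q f (totalD μ Q f z) ∈ coordsIn Q r k (Ideal.span (Set.range a))) ∧
    ∀ i ≠ 0, ∀ z ∈ totalDeg Q r k i,
      totalD μ Q f z ∈ coordsIn Q r k (Ideal.span (Set.range a)) →
      ∃ u ∈ totalDeg Q r k (i + 1), z - totalD μ Q f u ∈ coordsIn Q r k (Ideal.span (Set.range a)) := by
  induction k with
  | zero =>
    have hJ : Ideal.span (Set.range a) = ⊥ := by simp
    simp only [hJ]
    refine ⟨fun z u S => ?_, fun i hi z hz hcyc => ?_⟩
    · simp [totalD_apply, taylorD_taylorD]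
    · rcases lt_or_ge i 0 with hneg | hpos
      · exact ⟨0, zero_mem _, by simp [totalDeg_neg hneg hz, zero_mem]⟩
      · lift i to ℕ using hpos
        obtain ⟨y, hy, hyz⟩ := taylorD_exact (𝕜 := 𝕜) μ (i := i) (by exact_mod_cast hi)
          (z default) (fun T hT => hz _ _ (by simpa using hT)) (by
            ext1 S
            have h := hcyc default S
            rwa [totalD_apply, Fin.sum_univ_zero, add_zero] at h)
        refine ⟨fun _ => y, fun u S h => hy S fun h' => h (by rw [h', Fin.sum_univ_zero]; push_cast; ring), fun u S => ?_⟩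
        have hu : totalD μ Q f (fun _ => y) u = z default := by
          rw [totalD_apply, hyz, Fin.sum_univ_zero, add_zero]
        rw [Pi.sub_apply, hu, Subsingleton.elim u default, sub_self]
        exact zero_mem _
  | succ k ih =>
    set J := Ideal.span (Set.range fun j : Fin k => a j.castSucc) with hJdef
    set J' := Ideal.span (Set.range a) with hJ'def
    have hJJ' : J' = J ⊔ Ideal.span {a (Fin.last k)} := span_range_succ a
    have hJle : J ≤ J' := hJJ' ▸ le_sup_left
    have hlast : a (Fin.last k) ∈ J' := Ideal.subset_span ⟨_, rfl⟩
    have himg : ∀ j : Fin k, (fun i : Fin k => a i.castSucc) '' {i | i < j} =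
        a '' {i | i < j.castSucc} := by
      intro j
      ext x
      constructor
      · rintro ⟨i, hi, rfl⟩
        exact ⟨i.castSucc, hi, rfl⟩
      · rintro ⟨i, hi, rfl⟩
        refine ⟨i.castPred (Fin.ne_last_of_lt hi), ?_, by simp⟩
        exact hi
    have himg' : a '' {i | i < Fin.last k} = Set.range fun j : Fin k => a j.castSucc := by
      ext x
      constructor
      · rintro ⟨i, hi, rfl⟩
        exact ⟨i.castPred (Fin.ne_last_of_lt hi), by simp⟩
      · rintro ⟨i, rfl⟩
        exact ⟨i.castSucc, i.castSucc_lt_last, rfl⟩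
    have hregl : ∀ x, a (Fin.last k) * x ∈ J → x ∈ J := by
      have := hreg (Fin.last k)
      rwa [himg'] at this
    obtain ⟨ihD, ihE⟩ := ih (fun j => a j.castSucc) (fun j => f j.castSucc)
      (fun i => haf i.castSucc) (fun j x => by simpa only [himg] using hreg j.castSucc x)
    set D := totalD μ Q fun j => f j.castSucc
    set H := totalH μ Q k (f (Fin.last k))
    have hDH : ∀ v, D (H v) + H (D v) = a (Fin.last k) • v := fun v => by
      rw [haf]
      exact totalD_totalH μ _ _ v
    have hHH : ∀ v, H (H v) = 0 := totalH_totalH_self μ _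
    have hmem : ∀ z : (Fin (k + 1) → ℕ) → Finset (Fin r) → Q,
        z ∈ coordsIn Q r (k + 1) J' ↔
          ∀ l, (fun v => z (Fin.snoc v l)) ∈ coordsIn Q r k J' := by
      refine fun z => ⟨fun h l u S => h _ _, fun h u S => ?_⟩
      have := h (u (Fin.last k)) (Fin.init u) S
      simpa only [Fin.snoc_init_self] using this
    have hslice : ∀ (z : (Fin (k + 1) → ℕ) → Finset (Fin r) → Q) (l : ℕ),
        (fun v => totalD μ Q f z (Fin.snoc v l)) =
          D (fun v => z (Fin.snoc v l)) + H (fun v => z (Fin.snoc v (l + 1))) :=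
      fun z l => funext fun v => totalD_snoc μ f z v l
    have hmono : coordsIn Q r k J ≤ coordsIn Q r k J' := fun z hz u S => hJle (hz u S)
    have hsmul : ∀ v, a (Fin.last k) • v ∈ coordsIn Q r k J' := fun v u S =>
      Ideal.mul_mem_right _ _ hlast
    constructor
    · intro z
      rw [hmem]
      intro l
      rw [hslice, hslice, hslice, map_add, map_add, hHH, add_zero, add_assoc, hDH]
      exact add_mem (hmono (ihD _)) (hsmul _)
    · intro i hi z hz hcyc
      have hlift : ∀ i, ∀ v ∈ totalDeg Q r k i, v ∈ coordsIn Q r k J' →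
          ∃ w ∈ totalDeg Q r k i, v - a (Fin.last k) • w ∈ coordsIn Q r k J := by
        intro i v hv hvN
        -- Choosing `0` wherever `v` vanishes keeps `w` homogeneous of the same degree.
        have : ∀ u S, ∃ w, (v u S = 0 → w = 0) ∧ v u S - a (Fin.last k) * w ∈ J := by
          intro u S
          by_cases h0 : v u S = 0
          · exact ⟨0, fun _ => rfl, by simp [h0]⟩
          · have h1 := hvN u S
            rw [hJJ', Submodule.mem_sup] at h1
            obtain ⟨y, hy, x, hx, hxy⟩ := h1
            obtain ⟨w, rfl⟩ := Ideal.mem_span_singleton'.1 hx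
            refine ⟨w, fun h => absurd h h0, ?_⟩
            rw [← hxy, mul_comm, add_sub_cancel_right]
            exact hy
        choose w hw0 hw using this
        exact ⟨w, fun u S h => hw0 _ _ (hv u S h), hw⟩
      -- The families are sliced by the last exponent `l`. Slice `l` has degree `i - 2l`, which is
      -- negative from `l = i.toNat + 1` on, so the slices vanish there.
      obtain ⟨u, hu, hu'⟩ := shamash_step (totalDeg Q r k) (coordsIn Q r k J) (coordsIn Q r k J')
        D.toAddMonoidHom H.toAddMonoidHom
        (LinearMap.lsmul Q ((Fin k → ℕ) → Finset (Fin r) → Q) (a (Fin.last k))).toAddMonoidHom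
        (fun i hi v hv => totalDeg_neg hi hv) (fun i v hv => totalD_deg μ _ hv)
        (fun i v hv => totalH_deg μ _ hv) (fun v hv => totalD_mem μ _ hv)
        (fun v hv => totalH_mem μ _ hv) ihD hDH hHH (fun v hv => totalH_mem μ _ hv)
        (fun v hv u S => hregl _ (hv u S)) hmono hsmul hlift ihE hi (i.toNat + 1)
        (fun l v => z (Fin.snoc v l)) (totalDeg_snoc hz)
        (fun l hl => by
          rw [totalDeg_neg (by omega) (totalDeg_snoc hz l)]
          exact zero_mem _)
        (fun l => by
          have := (hmem _).1 hcyc l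
          rwa [hslice] at this)
      refine ⟨fun v => u (v (Fin.last k)) (Fin.init v), fun v S h => hu _ _ _ ?_, ?_⟩
      · rw [Fin.sum_univ_castSucc] at h
        intro h'
        apply h
        simp only [Fin.init] at h'
        push_cast at h' ⊢
        linarith
      · rw [hmem]
        intro l
        have := hu' l
        convert this using 1
        ext1 v
        simp only [Pi.sub_apply, totalD_snoc, Fin.snoc_last, Fin.init_snoc]
        rfl

end Total

/-! ### From basis elements of `Φ` to coordinates. -/

section Transfer

variable {𝕜 : Type u} [Field 𝕜] {n r c : ℕ} (μ : Fin r → (Fin n →₀ ℕ))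
  (a : Fin c → MvPolynomial (Fin n) 𝕜)

local notation "Q" => MvPolynomial (Fin n) 𝕜

lemma sum_subtype_ite {ι A : Type*} [Fintype ι] [AddCommMonoid A] (P : ι → Prop) [DecidablePred P]
    [Fintype {s // P s}] (F : ι → A) : ∑ s : {s // P s}, F s.1 = ∑ s, if P s then F s else 0 := by
  rw [← Finset.sum_filter, Finset.sum_subtype _ (p := P) (by simp)]

/-- The coordinates of an element of `Φᵢ`, extended by zero to all pairs `(u, S)`. -/
def coords (i : ℕ) :
    Term r a i →ₗ[CIRing a] ((Fin c → ℕ) → Finset (Fin r) → CIRing a) where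
  toFun z u S := if h : 2 * ∑ j, u j + S.card = i then z ⟨(u, S), h⟩ else 0
  map_add' x y := by
    ext u S
    by_cases h : 2 * ∑ j, u j + S.card = i <;> simp [h]
  map_smul' q x := by
    ext u S
    by_cases h : 2 * ∑ j, u j + S.card = i <;> simp [h]

variable {a}

lemma coords_apply {i : ℕ} (z : Term r a i) (u : Fin c → ℕ) (S : Finset (Fin r)) :
    coords a i z u S = if h : 2 * ∑ j, u j + S.card = i then z ⟨(u, S), h⟩ else 0 := rfl

lemma coords_of_label {i : ℕ} (z : Term r a i) (p : Label c r i) :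
    coords a i z p.1.1 p.1.2 = z p := dif_pos p.2

lemma coords_single {i : ℕ} (p : Label c r i) (x : CIRing a) (u : Fin c → ℕ)
    (S : Finset (Fin r)) :
    coords a i (Finsupp.single p x) u S = if p.1 = (u, S) then x else 0 := by
  rw [coords_apply]
  by_cases hp : p.1 = (u, S)
  · have h := p.2
    rw [hp] at h
    rw [dif_pos h, if_pos hp, Finsupp.single_apply, if_pos (Subtype.ext hp)]
  · rw [if_neg hp]
    split_ifs with h
    · rw [Finsupp.single_apply, if_neg fun e => hp (congrArg Subtype.val e)]
    · rfl

lemma coords_injective (i : ℕ) : Function.Injective (coords (r := r) a i) := by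
  intro x y h
  ext p
  rw [← coords_of_label x, ← coords_of_label y, h]

lemma toCI_mul (q : Q) (x : CIRing a) : toCI a q * x = q • x := rfl

lemma toCI_sgn (s : Fin r) (S : Finset (Fin r)) : toCI a (sgn Q s S) = sgn (CIRing a) s S := by
  simp [sgn]

lemma single_pos_and_eq {u v : Fin c → ℕ} {j : Fin c} :
    (0 < v j ∧ v - Pi.single j 1 = u) ↔ v = u + Pi.single j 1 := by
  constructor
  · rintro ⟨h, rfl⟩
    ext l
    by_cases hl : l = j
    · subst hl; simp; omega
    · simp [hl]
  · rintro rfl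
    exact ⟨by simp, by simp⟩

/-- Transposition of one matrix: `diff` lists the targets of a basis element, while `totalD`
collects at `(u, T)` the sources `(u, T ∪ s)` and `(u + e_j, T ∖ t)`. On a single basis element the
nonzero terms match one by one. -/
lemma coords_diff (f : Fin c → Fin r → Q) (i : ℕ) (z : Term r a (i + 1)) :
    coords a i (diff a μ f i z) = totalD μ (CIRing a) f (coords a (i + 1) z) := by
  induction z using Finsupp.induction_linear with
  | zero => simp
  | add x y hx hy => rw [map_add, map_add, map_add, map_add, hx, hy]
  | single p x =>
    ext u T
    rw [diff, Finsupp.linearCombination_single, map_smul, diffBasis, map_add, map_sum, map_sum,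
      totalD_apply]
    simp only [map_sum, Pi.smul_apply, Pi.add_apply, Finset.sum_apply, coords_single,
      taylorD_apply, taylorH_apply]
    rw [smul_add]
    congr 1
    · rw [sum_subtype_ite (fun s => s ∈ p.1.2) (fun s => if (p.1.1, p.1.2.erase s) = (u, T) then
        sgn (CIRing a) s p.1.2 * toCI a (MvPolynomial.monomial
          (lcmExp μ p.1.2 - lcmExp μ (p.1.2.erase s)) 1) else 0), Finset.smul_sum]
      refine Finset.sum_congr rfl fun s _ => ?_
      by_cases hp : s ∉ T ∧ p.1 = (u, insert s T)
      · obtain ⟨hs, hp⟩ := hp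
        simp [hp, hs, ← toCI_sgn (a := a), sgn_insert_self, ← map_mul, ← toCI_mul, mul_comm x]
      · have h1 : ¬ (s ∈ p.1.2 ∧ (p.1.1, p.1.2.erase s) = (u, T)) := by
          rintro ⟨h1, h2⟩
          rw [Prod.mk.injEq] at h2
          apply hp
          rw [← h2.2]
          exact ⟨Finset.notMem_erase _ _, Prod.ext h2.1 (Finset.insert_erase h1).symm⟩
        rw [← ite_and, if_neg h1, smul_zero]
        split_ifs with h2 h3
        · rfl
        · exact absurd ⟨h2, h3⟩ hp
        · rw [smul_zero]
    · let G : Fin c → Fin r → CIRing a := fun j t =>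
        if (p.1.1 - Pi.single j 1, insert t p.1.2) = (u, T) then
          sgn (CIRing a) t p.1.2 * toCI a (f j t * MvPolynomial.monomial
            (μ t + lcmExp μ p.1.2 - lcmExp μ (insert t p.1.2)) 1) else 0
      refine (congrArg (x • ·) ((Finset.sum_congr rfl fun j _ =>
        sum_subtype_ite (fun t => t ∉ p.1.2) (G j.1)).trans
        (sum_subtype_ite (fun j => 0 < p.1.1 j)
          fun j => ∑ t, if t ∉ p.1.2 then G j t else 0))).trans ?_
      simp only [Finset.smul_sum, smul_ite, smul_zero, G]
      refine Finset.sum_congr rfl fun j _ => ?_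
      by_cases hj : 0 < p.1.1 j ∧ p.1.1 - Pi.single j 1 = u
      · rw [if_pos hj.1]
        refine Finset.sum_congr rfl fun t _ => ?_
        have hu := single_pos_and_eq.1 hj
        by_cases hp : t ∈ T ∧ p.1.2 = T.erase t
        · obtain ⟨ht, hp⟩ := hp
          have hpe : p.1 = (u + Pi.single j 1, T.erase t) := Prod.ext hu hp
          simp only [hpe, ht, Finset.notMem_erase, Finset.insert_erase ht, not_false_eq_true,
            if_true, add_tsub_cancel_right, smul_eq_mul, sgn_erase_self]
          rw [← toCI_sgn, ← map_mul, ← toCI_mul, mul_comm x]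
        · have h1 : ¬ (t ∉ p.1.2 ∧ (p.1.1 - Pi.single j 1, insert t p.1.2) = (u, T)) := by
            rintro ⟨h1, h2⟩
            rw [Prod.mk.injEq] at h2
            apply hp
            rw [← h2.2]
            exact ⟨Finset.mem_insert_self _ _, (Finset.erase_insert h1).symm⟩
          rw [← ite_and, if_neg h1]
          split_ifs with h2 h3
          · exact absurd ⟨h2, congrArg Prod.snd h3⟩ hp
          · rfl
          · rfl
      · have h1 : ∀ t, p.1 ≠ (u + Pi.single j 1, T.erase t) := fun t h =>
          hj (single_pos_and_eq.2 (congrArg Prod.fst h))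
        simp only [h1, if_false, ite_self, Finset.sum_const_zero]
        split_ifs with h2
        · refine Finset.sum_eq_zero fun t _ => ?_
          rw [if_neg (fun h => hj ⟨h2, congrArg Prod.fst h⟩), ite_self]
        · rfl

end Transfer

/-! ### Exactness over the quotient ring. -/

section Exactness

variable {𝕜 : Type u} [Field 𝕜] {n r c : ℕ} (μ : Fin r → (Fin n →₀ ℕ))
  (a : Fin c → MvPolynomial (Fin n) 𝕜)

local notation "Q" => MvPolynomial (Fin n) 𝕜

instance finite_label (c r i : ℕ) : Finite (Label c r i) := by
  refine Finite.of_injective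
    (fun p : Label c r i => ((fun j => ⟨p.1.1 j, ?_⟩ : Fin c → Fin (i + 1)), p.1.2)) ?_
  · have h := p.2
    have := Finset.single_le_sum (f := p.1.1) (fun _ _ => Nat.zero_le _) (Finset.mem_univ j)
    omega
  · intro p q h
    simp only [Prod.mk.injEq, funext_iff, Fin.mk.injEq] at h
    exact Subtype.ext (Prod.ext (funext h.1) h.2)

lemma taylorD_map {M M' : Type*} [AddCommGroup M] [Module Q M] [AddCommGroup M'] [Module Q M']
    (L : M →ₗ[Q] M') (x : Finset (Fin r) → M) (T : Finset (Fin r)) :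
    taylorD (𝕜 := 𝕜) μ M' (fun S => L (x S)) T = L (taylorD (𝕜 := 𝕜) μ M x T) := by
  rw [taylorD_apply, taylorD_apply, map_sum]
  refine Finset.sum_congr rfl fun s _ => ?_
  split_ifs <;> simp

lemma taylorH_map {M M' : Type*} [AddCommGroup M] [Module Q M] [AddCommGroup M'] [Module Q M']
    (L : M →ₗ[Q] M') (g : Fin r → Q) (x : Finset (Fin r) → M) (T : Finset (Fin r)) :
    taylorH μ M' g (fun S => L (x S)) T = L (taylorH μ M g x T) := by
  rw [taylorH_apply, taylorH_apply, map_sum]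
  refine Finset.sum_congr rfl fun s _ => ?_
  split_ifs <;> simp

/-- Naturality in the coefficients; applied to `Q → R`, it reduces identities between lifts modulo
`a`. -/
lemma totalD_map {M M' : Type*} [AddCommGroup M] [Module Q M] [AddCommGroup M'] [Module Q M']
    (L : M →ₗ[Q] M') (f : Fin c → Fin r → Q) (z : (Fin c → ℕ) → Finset (Fin r) → M) :
    totalD μ M' f (fun u S => L (z u S)) = fun u S => L (totalD μ M f z u S) := by
  ext u S
  simp only [totalD_apply, Pi.add_apply, Finset.sum_apply, map_add, map_sum, taylorD_map,
    taylorH_map]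

lemma totalD_toCI (f : Fin c → Fin r → Q) (z : (Fin c → ℕ) → Finset (Fin r) → Q) :
    totalD μ (CIRing a) f (fun u S => toCI a (z u S)) = fun u S => toCI a (totalD μ Q f z u S) :=
  totalD_map μ (Algebra.linearMap Q (CIRing a)) f z

variable {a}

lemma exists_lift_coords {i : ℕ} (z : Term r a i) :
    ∃ Z ∈ totalDeg Q r c i, coords a i z = fun u S => toCI a (Z u S) := by
  have : ∀ u S, ∃ q : Q, (coords a i z u S = 0 → q = 0) ∧ coords a i z u S = toCI a q := by
    intro u S
    by_cases h : coords a i z u S = 0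
    · exact ⟨0, fun _ => rfl, by rw [h, map_zero]⟩
    · obtain ⟨q, hq⟩ := Ideal.Quotient.mk_surjective (coords a i z u S)
      exact ⟨q, fun h' => absurd h' h, hq.symm⟩
  choose Z hZ0 hZ using this
  refine ⟨Z, fun u S h => hZ0 u S ?_, funext fun u => funext fun S => hZ u S⟩
  rw [coords_apply, dif_neg (by exact_mod_cast h)]

lemma exists_coords_eq {i : ℕ} {Z : (Fin c → ℕ) → Finset (Fin r) → Q}
    (hZ : Z ∈ totalDeg Q r c i) : ∃ z : Term r a i, coords a i z = fun u S => toCI a (Z u S) := by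
  refine ⟨Finsupp.equivFunOnFinite.symm fun p => toCI a (Z p.1.1 p.1.2), ?_⟩
  ext u S
  rw [coords_apply]
  split_ifs with h
  · rfl
  · rw [hZ u S (by exact_mod_cast h), map_zero]

lemma regular_of_isWeaklyRegular
    (ha : RingTheory.Sequence.IsWeaklyRegular Q (List.ofFn a)) (j : Fin c) (x : Q)
    (hx : a j * x ∈ Ideal.span (a '' {i | i < j})) : x ∈ Ideal.span (a '' {i | i < j}) := by
  have h := ha.regular_mod_prev j (by simp)
  have e : (Ideal.ofList ((List.ofFn a).take j) • ⊤ : Submodule Q Q) =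
      Ideal.span (a '' {i | i < j}) := by
    rw [smul_eq_mul, Ideal.mul_top, Ideal.ofList]
    congr 1
    ext q
    simp only [Set.mem_ofPred_eq, List.mem_take_iff_getElem, List.getElem_ofFn, List.length_ofFn,
      Set.mem_image]
    constructor
    · rintro ⟨i, hi, rfl⟩
      exact ⟨⟨i, by omega⟩, by simp only [Fin.lt_def]; omega, rfl⟩
    · rintro ⟨i, hi, rfl⟩
      exact ⟨i, by simp only [Fin.lt_def] at hi; omega, rfl⟩
  rw [e, List.getElem_ofFn] at h
  rw [← Submodule.Quotient.mk_eq_zero] at hx ⊢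
  exact h (hx.trans (smul_zero _).symm)

lemma diff_exact_succ (f : Fin c → Fin r → Q)
    (ha : RingTheory.Sequence.IsWeaklyRegular Q (List.ofFn a))
    (haf : ∀ i, a i = ∑ t, f i t * MvPolynomial.monomial (μ t) 1) (i : ℕ) :
    Function.Exact (diff a μ f (i + 1)) (diff a μ f i) := by
  obtain ⟨hDD, hex⟩ := totalD_exact μ a f haf (regular_of_isWeaklyRegular ha)
  intro z
  constructor
  · intro hz
    obtain ⟨Z, hZ, hzZ⟩ := exists_lift_coords z
    obtain ⟨U, hU, hZU⟩ := hex (i + 1 : ℕ) (by omega) Z hZ fun u S => by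
      have h := congrFun (congrFun (coords_diff μ f i z) u) S
      rw [hz, map_zero, hzZ, totalD_toCI] at h
      exact Ideal.Quotient.eq_zero_iff_mem.1 h.symm
    obtain ⟨w, hw⟩ := exists_coords_eq (a := a) (i := i + 1 + 1) hU
    refine ⟨w, coords_injective _ ?_⟩
    rw [coords_diff, hw, totalD_toCI, hzZ]
    ext u S
    exact (Ideal.Quotient.eq.2 (hZU u S)).symm
  · rintro ⟨w, rfl⟩
    obtain ⟨W, -, hwW⟩ := exists_lift_coords w
    apply coords_injective
    rw [coords_diff, coords_diff, hwW, totalD_toCI, totalD_toCI, map_zero]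
    ext u S
    exact Ideal.Quotient.eq_zero_iff_mem.2 (hDD W u S)

lemma aug_apply (z : Term r a 0) :
    aug a μ z = Ideal.Quotient.mk _ (coords a 0 z 0 ∅) := by
  induction z using Finsupp.induction_linear with
  | zero => simp
  | add x y hx hy => rw [map_add, hx, hy, map_add, Pi.add_apply, Pi.add_apply, map_add]
  | single p x =>
    have hp : p.1 = (0, ∅) := by
      have h := p.2
      have h1 : ∑ j, p.1.1 j = 0 := by omega
      refine Prod.ext (funext fun j => ?_) (Finset.card_eq_zero.1 (by omega))
      exact (Finset.sum_eq_zero_iff.1 h1) j (Finset.mem_univ j)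
    rw [coords_single, if_pos hp, aug, Finsupp.linearCombination_single]
    exact congrArg (Ideal.Quotient.mk _) (mul_one x)

lemma coords_diff_zero (f : Fin c → Fin r → Q) (z : Term r a 1) :
    coords a 0 (diff a μ f 0 z) 0 ∅ =
      ∑ s, toCI a (MvPolynomial.monomial (μ s) 1) * coords a 1 z 0 {s} := by
  rw [coords_diff, totalD_apply, Pi.add_apply, Finset.sum_apply,
    Finset.sum_eq_zero fun j _ => taylorH_eq_zero μ _ (by simp), add_zero, taylorD_apply]
  refine Finset.sum_congr rfl fun s _ => ?_
  simp [sgn, lcmExp, toCI_mul, bot_eq_zero]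

lemma map_monIdeal : (monIdeal 𝕜 μ).map (toCI a) =
    Ideal.span (Set.range fun t => toCI a (MvPolynomial.monomial (μ t) (1 : 𝕜))) := by
  rw [monIdeal, Ideal.map_span, ← Set.range_comp]
  rfl

/-- In degree one only the labels `(0, {s})` exist, so the image of the first differential is the
ideal generated by the monomials, which is the kernel of the augmentation. -/
lemma diff_exact_zero (f : Fin c → Fin r → Q) : Function.Exact (diff a μ f 0) (aug a μ) := by
  intro z
  rw [aug_apply, Ideal.Quotient.eq_zero_iff_mem, map_monIdeal]
  constructor
  · intro hz
    obtain ⟨g, hg⟩ := Ideal.mem_span_range_iff_exists_fun.1 hz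
    have hl : ∀ s : Fin r, 2 * ∑ j, (0 : Fin c → ℕ) j + ({s} : Finset (Fin r)).card = 1 := by simp
    refine ⟨∑ s, Finsupp.single ⟨(0, {s}), hl s⟩ (g s), coords_injective _ ?_⟩
    ext u S
    by_cases h : 2 * ∑ j, u j + S.card = 0
    · obtain rfl : u = 0 := by
        have h1 : ∑ j, u j = 0 := by omega
        exact funext fun j => (Finset.sum_eq_zero_iff.1 h1) j (Finset.mem_univ j)
      obtain rfl : S = ∅ := Finset.card_eq_zero.1 (by omega)
      rw [coords_diff_zero, ← hg]
      refine Finset.sum_congr rfl fun t _ => ?_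
      rw [map_sum, Finset.sum_apply, Finset.sum_apply, mul_comm]
      simp [coords_single]
    · rw [coords_apply, coords_apply, dif_neg h, dif_neg h]
  · rintro ⟨w, rfl⟩
    rw [coords_diff_zero]
    exact sum_mem fun t _ => Ideal.mul_mem_right _ _ (Ideal.subset_span ⟨t, rfl⟩)

lemma aug_surjective : Function.Surjective (aug a μ) := by
  intro y
  obtain ⟨x, rfl⟩ := Ideal.Quotient.mk_surjective y
  refine ⟨Finsupp.single ⟨(0, ∅), by simp⟩ x, ?_⟩
  rw [aug_apply, coords_single, if_pos rfl]

theorem isFreeResolution (f : Fin c → Fin r → Q)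
    (ha : RingTheory.Sequence.IsWeaklyRegular Q (List.ofFn a))
    (haf : ∀ i, a i = ∑ t, f i t * MvPolynomial.monomial (μ t) 1) :
    IsFreeResolution (Term r a) (diff a μ f) (aug a μ) where
  free _ := inferInstance
  surjective := aug_surjective μ
  exact_zero := diff_exact_zero μ f
  exact_succ := diff_exact_succ μ f ha haf

end Exactness

/-! ### Bounding Tor by the terms of a free resolution. -/

section TorRank

variable {R : Type u} [CommRing R] {N : Type u} [AddCommGroup N] [Module R N]
  {F : ℕ → Type u} [∀ i, AddCommGroup (F i)] [∀ i, Module R (F i)]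
  {d : ∀ i, F (i + 1) →ₗ[R] F i} {ε : F 0 →ₗ[R] N}

/-- The chain complex of a free resolution. -/
def IsFreeResolution.complex (h : IsFreeResolution F d ε) : ChainComplex (ModuleCat.{u} R) ℕ :=
  ChainComplex.of (fun i => ModuleCat.of R (F i)) (fun i => ModuleCat.ofHom (d i)) fun i => by
    ext x
    exact (h.exact_succ i).apply_apply_eq_zero x

lemma IsFreeResolution.complex_d (h : IsFreeResolution F d ε) (i : ℕ) :
    h.complex.d (i + 1) i = ModuleCat.ofHom (d i) :=
  ChainComplex.of_d (fun i => ModuleCat.of R (F i)) (fun i => ModuleCat.ofHom (d i)) i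

lemma IsFreeResolution.complex_d_zero_comp (h : IsFreeResolution F d ε) :
    h.complex.d 1 0 ≫ ModuleCat.ofHom ε = 0 := by
  rw [h.complex_d 0]
  ext x
  exact h.exact_zero.apply_apply_eq_zero x

/-- The augmentation of a free resolution as a morphism of complexes. -/
def IsFreeResolution.π (h : IsFreeResolution F d ε) :
    h.complex ⟶ (ChainComplex.single₀ (ModuleCat.{u} R)).obj (ModuleCat.of R N) :=
  (h.complex.toSingle₀Equiv _).symm ⟨ModuleCat.ofHom ε, h.complex_d_zero_comp⟩

lemma IsFreeResolution.quasiIso (h : IsFreeResolution F d ε) : QuasiIso h.π where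
  quasiIsoAt m := by
    cases m with
    | zero =>
      rw [ChainComplex.quasiIsoAt₀_iff, ShortComplex.quasiIso_iff_of_zeros' _
        (h.complex.shape _ _ (by simp)) rfl rfl]
      have e : h.π.f 0 = ModuleCat.ofHom ε :=
        ChainComplex.toSingle₀Equiv_symm_apply_f_zero _ h.complex_d_zero_comp
      constructor
      · rw [ShortComplex.moduleCat_exact_iff]
        intro x hx
        have hx' : ε x = 0 := by
          have : (h.π.f 0).hom x = 0 := hx
          rwa [e] at this
        obtain ⟨y, hy⟩ := (h.exact_zero x).1 hx'
        refine ⟨y, ?_⟩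
        change (h.complex.d 1 0).hom y = x
        rw [h.complex_d 0]
        exact hy
      · change Epi (h.π.f 0)
        rw [e]
        exact (ModuleCat.epi_iff_surjective (ModuleCat.ofHom ε)).2 h.surjective
    | succ m =>
      rw [quasiIsoAt_iff_exactAt' (hL := ChainComplex.exactAt_succ_single_obj ..),
        HomologicalComplex.exactAt_iff' _ (m + 2) (m + 1) m (by simp) (by simp),
        ShortComplex.moduleCat_exact_iff]
      intro x hx
      have hx' : d m x = 0 := by
        have : (h.complex.d (m + 1) m).hom x = 0 := hx
        rwa [h.complex_d m] at this
      obtain ⟨y, hy⟩ := (h.exact_succ m x).1 hx'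
      refine ⟨y, ?_⟩
      change (h.complex.d (m + 2) (m + 1)).hom y = x
      rw [h.complex_d (m + 1)]
      exact hy

/-- A free resolution as a projective resolution in the category of modules. -/
def IsFreeResolution.projectiveResolution (h : IsFreeResolution F d ε) :
    ProjectiveResolution (ModuleCat.of R N) where
  complex := h.complex
  projective i := by
    have := h.free i
    exact ModuleCat.projective_of_categoryTheory_projective (ModuleCat.of R (F i))
  π := h.π
  quasiIso := h.quasiIso

variable (𝕜 : Type u) [Field 𝕜] [Algebra 𝕜 R]

/-- An `R`-linear map as a `𝕜`-linear map. -/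
def restrictScalarsMap {X Y : Type u} [AddCommGroup X] [Module R X] [AddCommGroup Y] [Module R Y]
    (f : X →ₗ[R] Y) : RestrictScalars 𝕜 R X →ₗ[𝕜] RestrictScalars 𝕜 R Y where
  toFun := f
  map_add' := f.map_add
  map_smul' q x := f.map_smul (algebraMap 𝕜 R q) x

lemma rank_restrictScalars_le_of_injective {X Y : Type u} [AddCommGroup X] [Module R X]
    [AddCommGroup Y] [Module R Y] (f : X →ₗ[R] Y) (hf : Function.Injective f) :
    Module.rank 𝕜 (RestrictScalars 𝕜 R X) ≤ Module.rank 𝕜 (RestrictScalars 𝕜 R Y) :=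
  LinearMap.rank_le_of_injective (restrictScalarsMap 𝕜 f) hf

lemma rank_restrictScalars_le_of_surjective {X Y : Type u} [AddCommGroup X] [Module R X]
    [AddCommGroup Y] [Module R Y] (f : X →ₗ[R] Y) (hf : Function.Surjective f) :
    Module.rank 𝕜 (RestrictScalars 𝕜 R Y) ≤ Module.rank 𝕜 (RestrictScalars 𝕜 R X) :=
  LinearMap.rank_le_of_surjective (restrictScalarsMap 𝕜 f) hf

theorem IsFreeResolution.rank_tor_le (h : IsFreeResolution F d ε) (M : Type u) [AddCommGroup M]
    [Module R M] (i : ℕ) :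
    Module.rank 𝕜 (RestrictScalars 𝕜 R (((Tor (ModuleCat.{u} R) i).obj (ModuleCat.of R M)).obj
      (ModuleCat.of R N))) ≤ Module.rank 𝕜 (RestrictScalars 𝕜 R (TensorProduct R M (F i))) := by
  let G := (MonoidalCategory.tensoringLeft (ModuleCat.{u} R)).obj (ModuleCat.of R M)
  let K := (G.mapHomologicalComplex (ComplexShape.down ℕ)).obj h.projectiveResolution.complex
  let e : ((Tor (ModuleCat.{u} R) i).obj (ModuleCat.of R M)).obj (ModuleCat.of R N) ≅
      K.homology i := h.projectiveResolution.isoLeftDerivedObj G i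
  -- Homology is a quotient of the cycles, which embed in the `i`-th term.
  calc _ ≤ Module.rank 𝕜 (RestrictScalars 𝕜 R (K.homology i)) :=
        rank_restrictScalars_le_of_injective 𝕜 e.hom.hom
          ((ModuleCat.mono_iff_injective _).1 inferInstance)
    _ ≤ Module.rank 𝕜 (RestrictScalars 𝕜 R (K.cycles i)) :=
        rank_restrictScalars_le_of_surjective 𝕜 (K.homologyπ i).hom
          ((ModuleCat.epi_iff_surjective _).1 inferInstance)
    _ ≤ Module.rank 𝕜 (RestrictScalars 𝕜 R (K.X i)) :=
        rank_restrictScalars_le_of_injective 𝕜 (K.iCycles i).hom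
          ((ModuleCat.mono_iff_injective _).1 inferInstance)
    _ = _ := rfl

end TorRank

/-! ### Counting labels. -/

section Counting

lemma card_sum_eq {c : ℕ} (hc : 1 ≤ c) (k : ℕ) :
    Nat.card {u : Fin c → ℕ // ∑ j, u j = k} = (c + k - 1).choose (c - 1) := by
  rw [← Nat.card_congr (Sym.equivNatSumOfFintype (Fin c) k), Nat.card_eq_fintype_card,
    Sym.card_sym_eq_choose, Fintype.card_fin]
  exact Nat.choose_symm_of_eq_add (by omega)

lemma sum_range_two_mul {A : Type*} [AddCommMonoid A] (g : ℕ → A) (m : ℕ) :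
    ∑ k ∈ Finset.range (2 * m), g k = ∑ j ∈ Finset.range m, (g (2 * j) + g (2 * j + 1)) := by
  induction m with
  | zero => simp
  | succ m ih => rw [Nat.mul_succ, Finset.sum_range_succ, Finset.sum_range_succ, ih,
      Finset.sum_range_succ, add_assoc]

lemma card_label (c r i : ℕ) :
    Nat.card (Label c r i) = ∑ k ∈ Finset.range (r + 1),
      r.choose k * Nat.card {u : Fin c → ℕ // 2 * ∑ j, u j + k = i} := by
  let e : Label c r i ≃ Σ S : Finset (Fin r), {u : Fin c → ℕ // 2 * ∑ j, u j + S.card = i} :=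
    { toFun := fun p => ⟨p.1.2, p.1.1, p.2⟩
      invFun := fun q => ⟨(q.2.1, q.1), q.2.2⟩
      left_inv := fun _ => rfl
      right_inv := fun _ => rfl }
  have hfin : ∀ S : Finset (Fin r), Finite {u : Fin c → ℕ // 2 * ∑ j, u j + S.card = i} :=
    fun S => Finite.of_injective (fun u => (⟨(u.1, S), u.2⟩ : Label c r i)) fun u v h =>
      Subtype.ext (congrArg (fun p : Label c r i => p.1.1) h)
  rw [Nat.card_congr e, Nat.card_sigma]
  have := Finset.sum_powerset_apply_card (x := (Finset.univ : Finset (Fin r)))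
    (fun k => Nat.card {u : Fin c → ℕ // 2 * ∑ j, u j + k = i})
  rwa [Finset.powerset_univ, Finset.card_univ, Fintype.card_fin] at this

/-- Terms with `k > r` vanish through the binomial, those with `k > i` through the degree condition,
so the summation range can be fitted to the parity split. -/
lemma card_label_eq_sum_range (c r i L : ℕ) (hL : i < L) :
    Nat.card (Label c r i) = ∑ k ∈ Finset.range L,
      r.choose k * Nat.card {u : Fin c → ℕ // 2 * ∑ j, u j + k = i} := by
  rw [card_label]
  have h1 : ∀ k, i < k → Nat.card {u : Fin c → ℕ // 2 * ∑ j, u j + k = i} = 0 := by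
    intro k hk
    have : IsEmpty {u : Fin c → ℕ // 2 * ∑ j, u j + k = i} := ⟨fun u => by have := u.2; omega⟩
    exact Nat.card_of_isEmpty
  refine (Finset.sum_subset (Finset.range_subset_range.2 (le_max_left (r + 1) L)) ?_).trans
    (Finset.sum_subset (Finset.range_subset_range.2 (le_max_right (r + 1) L)) ?_).symm
  · intro k _ hk
    rw [Nat.choose_eq_zero_of_lt (by simp at hk; omega), zero_mul]
  · intro k _ hk
    rw [h1 k (by simp at hk; omega), mul_zero]

lemma card_two_mul_sum {c : ℕ} (hc : 1 ≤ c) {i k l : ℕ} (h : i = 2 * l + k) :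
    Nat.card {u : Fin c → ℕ // 2 * ∑ j, u j + k = i} = (c + l - 1).choose (c - 1) := by
  rw [← card_sum_eq hc l]
  exact Nat.card_congr (Equiv.subtypeEquivRight fun u => by omega)

lemma card_two_mul_sum_of_odd {c : ℕ} {i k : ℕ} (h : (i + k) % 2 = 1) :
    Nat.card {u : Fin c → ℕ // 2 * ∑ j, u j + k = i} = 0 := by
  have : IsEmpty {u : Fin c → ℕ // 2 * ∑ j, u j + k = i} := ⟨fun u => by have := u.2; omega⟩
  exact Nat.card_of_isEmpty

lemma card_label_even {c : ℕ} (hc : 1 ≤ c) (r m : ℕ) :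
    Nat.card (Label c r (2 * m)) =
      ∑ j ∈ Finset.range (m + 1), r.choose (2 * j) * (c + m - j - 1).choose (c - 1) := by
  rw [card_label_eq_sum_range c r _ (2 * (m + 1)) (by omega), sum_range_two_mul]
  refine Finset.sum_congr rfl fun j hj => ?_
  have hj := Finset.mem_range.1 hj
  rw [card_two_mul_sum_of_odd (k := 2 * j + 1) (by omega), mul_zero, add_zero,
    card_two_mul_sum hc (l := m - j) (by omega), ← Nat.add_sub_assoc (by omega)]

lemma card_label_odd {c : ℕ} (hc : 1 ≤ c) (r m : ℕ) :
    Nat.card (Label c r (2 * m + 1)) =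
      ∑ j ∈ Finset.range (m + 1), r.choose (2 * j + 1) * (c + m - j - 1).choose (c - 1) := by
  rw [card_label_eq_sum_range c r _ (2 * (m + 1)) (by omega), sum_range_two_mul]
  refine Finset.sum_congr rfl fun j hj => ?_
  have hj := Finset.mem_range.1 hj
  rw [card_two_mul_sum_of_odd (k := 2 * j) (by omega), mul_zero, zero_add,
    card_two_mul_sum hc (l := m - j) (by omega), ← Nat.add_sub_assoc (by omega)]

lemma finrank_term {𝕜 : Type u} [Field 𝕜] {n c : ℕ} (r : ℕ) (a : Fin c → MvPolynomial (Fin n) 𝕜)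
    (ha : RingTheory.Sequence.IsRegular (MvPolynomial (Fin n) 𝕜) (List.ofFn a)) (i : ℕ) :
    Module.finrank (CIRing a) (Term r a i) = Nat.card (Label c r i) := by
  -- Ranks need a nonzero ring; this uses the part of regularity beyond weak regularity.
  have : Nontrivial (CIRing a) := by
    refine Ideal.Quotient.nontrivial_iff.2 fun h => ha.top_ne_smul ?_
    rw [smul_eq_mul, Ideal.mul_top, Ideal.ofList, ← h]
    congr 1
    ext
    simp
  have := Fintype.ofFinite (Label c r i)
  rw [Module.finrank_finsupp_self, Nat.card_eq_fintype_card]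

end Counting

/-! ### The bounds on Betti numbers. -/

section Betti

variable {𝕜 : Type u} [Field 𝕜] {n r c : ℕ} (μ : Fin r → (Fin n →₀ ℕ))
  (a : Fin c → MvPolynomial (Fin n) 𝕜)

/-- Every polynomial is its constant term modulo the variables. The module may be zero, so it has
dimension at most one over `𝕜`. -/
lemma exists_constant_resMod (m : ResMod a) :
    ∃ q : 𝕜, algebraMap 𝕜 (CIRing a) q • (1 : ResMod a) = m := by
  obtain ⟨x, rfl⟩ := Ideal.Quotient.mk_surjective m
  obtain ⟨p, rfl⟩ := Ideal.Quotient.mk_surjective x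
  suffices ∃ q : 𝕜, Ideal.Quotient.mk ((Ideal.span (Set.range
      (MvPolynomial.X : Fin n → MvPolynomial (Fin n) 𝕜))).map (toCI a))
      (toCI a (MvPolynomial.C q)) = Ideal.Quotient.mk _ (toCI a p) by
    obtain ⟨q, hq⟩ := this
    refine ⟨q, hq ▸ ?_⟩
    exact congrArg (Ideal.Quotient.mk _) (mul_one (toCI a (MvPolynomial.C q)))
  induction p using MvPolynomial.induction_on with
  | C q => exact ⟨q, rfl⟩
  | add p p' hp hp' =>
    obtain ⟨q, hq⟩ := hp
    obtain ⟨q', hq'⟩ := hp'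
    exact ⟨q + q', by simp only [map_add, hq, hq']⟩
  | mul_X p i _ =>
    refine ⟨0, ?_⟩
    rw [map_zero, map_zero, map_zero, eq_comm, Ideal.Quotient.eq_zero_iff_mem]
    exact Ideal.mem_map_of_mem _ (Ideal.mul_mem_left _ _ (Ideal.subset_span ⟨i, rfl⟩))

lemma rank_finsupp_resMod_le (ι : Type) [Finite ι] :
    Module.rank 𝕜 (RestrictScalars 𝕜 (CIRing a) (ι →₀ ResMod a)) ≤ (Nat.card ι : Cardinal.{u}) := by
  have := Fintype.ofFinite ι
  let v : ι → RestrictScalars 𝕜 (CIRing a) (ι →₀ ResMod a) := fun i =>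
    (Finsupp.single i 1 : ι →₀ ResMod a)
  have hs : Function.Surjective (Finsupp.linearCombination 𝕜 v) := by
    rw [← LinearMap.range_eq_top, eq_top_iff]
    rintro (x : ι →₀ ResMod a) -
    induction x using Finsupp.induction_linear with
    | zero => exact zero_mem _
    | add x y hx hy => exact add_mem hx hy
    | single i m =>
      obtain ⟨q, rfl⟩ := exists_constant_resMod a m
      refine ⟨Finsupp.single i q, ?_⟩
      rw [Finsupp.linearCombination_single]
      exact Finsupp.smul_single (algebraMap 𝕜 (CIRing a) q) i (1 : ResMod a)
  refine (LinearMap.rank_le_of_surjective _ hs).trans ?_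
  rw [rank_finsupp_self, Nat.card_eq_fintype_card, Cardinal.mk_fintype, Cardinal.lift_natCast]

theorem betti_le_card_label {a : Fin c → MvPolynomial (Fin n) 𝕜}
    (ha : RingTheory.Sequence.IsWeaklyRegular (MvPolynomial (Fin n) 𝕜) (List.ofFn a))
    (haI : Ideal.span (Set.range a) ≤ monIdeal 𝕜 μ) (i : ℕ) :
    betti a μ i ≤ (Nat.card (Label c r i) : Cardinal.{u}) := by
  have hf : ∀ i, ∃ g : Fin r → MvPolynomial (Fin n) 𝕜,
      ∑ t, g t * MvPolynomial.monomial (μ t) 1 = a i := fun i =>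
    Ideal.mem_span_range_iff_exists_fun.1 (haI (Ideal.subset_span ⟨i, rfl⟩))
  choose f hf using hf
  let e := TensorProduct.finsuppScalarRight (CIRing a) (CIRing a) (ResMod a) (Label c r i)
  exact ((isFreeResolution μ f ha fun i => (hf i).symm).rank_tor_le 𝕜 (ResMod a) i).trans
    ((rank_restrictScalars_le_of_injective 𝕜 e.toLinearMap e.injective).trans
      (rank_finsupp_resMod_le a _))

end Betti

end

end TaylorCI

theorem mainTheorem2 {𝕜 : Type u} [Field 𝕜] {n r c : ℕ} (hc : 1 ≤ c)
    (μ : Fin r → (Fin n →₀ ℕ)) (a : Fin c → MvPolynomial (Fin n) 𝕜)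
    (ha : RingTheory.Sequence.IsRegular (MvPolynomial (Fin n) 𝕜) (List.ofFn a))
    (haI : Ideal.span (Set.range a) ≤ TaylorCI.monIdeal 𝕜 μ) :
    (∀ m : ℕ,
      TaylorCI.betti a μ (2 * m) ≤
        ((∑ j ∈ Finset.range (m + 1), r.choose (2 * j) * (c + m - j - 1).choose (c - 1) : ℕ) : Cardinal.{u}) ∧
      TaylorCI.betti a μ (2 * m + 1) ≤
        ((∑ j ∈ Finset.range (m + 1), r.choose (2 * j + 1) * (c + m - j - 1).choose (c - 1) : ℕ) : Cardinal.{u})) ∧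
    (∀ f : Fin c → Fin r → MvPolynomial (Fin n) 𝕜,
      (∀ i, a i = ∑ t, f i t * MvPolynomial.monomial (μ t) 1) →
      TaylorCI.IsFreeResolution (TaylorCI.Term r a) (TaylorCI.diff a μ f) (TaylorCI.aug a μ)) ∧
    (∀ m : ℕ,
      Module.finrank (TaylorCI.CIRing a) (TaylorCI.Term r a (2 * m)) =
        ∑ j ∈ Finset.range (m + 1), r.choose (2 * j) * (c + m - j - 1).choose (c - 1) ∧
      Module.finrank (TaylorCI.CIRing a) (TaylorCI.Term r a (2 * m + 1)) =
        ∑ j ∈ Finset.range (m + 1), r.choose (2 * j + 1) * (c + m - j - 1).choose (c - 1)) := by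
  refine ⟨fun m => ?_, fun f hf => TaylorCI.isFreeResolution μ f ha.toIsWeaklyRegular hf,
    fun m => ?_⟩
  · rw [← TaylorCI.card_label_even hc, ← TaylorCI.card_label_odd hc]
    exact ⟨TaylorCI.betti_le_card_label μ ha.toIsWeaklyRegular haI _,
      TaylorCI.betti_le_card_label μ ha.toIsWeaklyRegular haI _⟩
  · rw [← TaylorCI.card_label_even hc, ← TaylorCI.card_label_odd hc]
    exact ⟨TaylorCI.finrank_term r a ha _, TaylorCI.finrank_term r a ha _⟩
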